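/- **Setting.** Identify $\mathbb T=\mathbb R/\mathbb Z$ with $[0,1)$ and regard functions on $\mathbb T$ as $1$-periodic. A *tile* $P=[\alpha,\omega,I]$ consists of half-open dyadic intervals $\alpha,\omega\subset\mathbb R$, $I\subseteq[0,1)$ with $|\alpha|=|\omega|=|I|^{-1}=2^k$, $k\ge 0$; it is viewed as the parallelogram with left vertical edge $\alpha$ (above the left endpoint of $I$) and right vertical edge $\omega$ (above the right endpoint of $I$). For $a>0$ let $aP=[a\alpha,a\omega,I]$, where $a\alpha,a\omega$ are the intervals with the same centers and $a$ times the lengths. For a non-vertical line $l$ (the graph of an affine function, also written $l$) write $l\in P$ if $l$ meets both vertical edges of $P$. Write $P_1\le P_2$ if $I_1\subseteq I_2$ and some line $l$ satisfies $l\in P_1$ and $l\in P_2$. For two (dilated) tiles with $|I_1|\ge|I_2|$ put $$\Delta(P_1,P_2)=\frac{1}{|\omega_2|}\inf_{l_1\in P_1,\;l_2\in P_2}\ \sup_{x\in I_2}|l_1(x)-l_2(x)|,\qquad \lceil x\rceil=\frac1{1+|x|}.$$ Fix integers $M\ge1$ and $r\ge 0$, and let $\mathbb P$ be the collection of all tiles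 with $|I|=2^{-k}$, $k\equiv r \pmod M$ (so $M=1$ gives all tiles, and $M=10$ gives a family in which different scales differ by a factor of at least $2^{10}$). Let $b,c:\mathbb R\to\mathbb R$ be measurable, $l_x(z)=c(x)+2b(x)z$, and $E(P)=\{x\in I: l_x\in P\}$. For $N\in\mathbb N$ the *mass* of $P$ is $$A(P)=\sup_{P'=[\alpha',\omega',I']\in\mathbb P,\ I\subseteq I'}\frac{|E(P')|}{|I'|}\,\lceil\Delta(2P,2P')\rceil^{N}.$$ Let $\psi:\mathbb R\to\mathbb R$ be an odd $C^\infty$ function with $\operatorname{supp}\psi\subseteq\{4<|y|<5\}$, $\psi_k(y)=2^k\psi(2^ky)$, and for $|I|=2^{-k}$ let $$T_Pf(x)=\chi_{E(P)}(x)\int_{-1/2}^{1/2}e^{i(l_x(x)y-b(x)y^2)}\psi_k(y)f(x-y)\,dy .$$ **Proposition 1.** For every $N\in\mathbb N$ there is $\eta\in(0,1/2)$, depending only on $N$, such that for every $\psi$ and $M$ as above there is a constant $C>0$, depending only on $N,\psi,M$, with the following property. Let $b,c$ be measurable, $r\ge0$, $\delta>0$, and let $\mathcal P\subseteq\mathbb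 P$ be any family of pairwise incomparable tiles ($P\not\le Q$ for all distinct $P,Q\in\mathcal P$) with $A(P)\le\delta$ for all $P\in\mathcal P$. Then, for every $f\in L^2(\mathbb T)$, the series $T^{\mathcal P}f(x)=\sum_{P\in\mathcal P}T_Pf(x)$ converges for almost every $x$, and it defines a bounded operator on $L^2(\mathbb T)$ with $$\|T^{\mathcal P}\|_{L^2\to L^2}\le C\,\delta^{\eta}.$$ -/

import Mathlib

open MeasureTheory Set

noncomputable section

namespace QuadCarleson

/-- A bounded half-open interval `[lo, lo + len)` of the real line. -/
structure Intvl where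
  lo : ℝ
  len : ℝ

namespace Intvl

/-- The right endpoint. -/
def hi (J : Intvl) : ℝ := J.lo + J.len

/-- The underlying set `[lo, lo + len)`. -/
def toSet (J : Intvl) : Set ℝ := Ico J.lo J.hi

/-- The center `c(J)`. -/
def center (J : Intvl) : ℝ := J.lo + J.len / 2

/-- `a J`: the interval with the same center as `J` and with length `a |J|`. -/
def dilate (a : ℝ) (J : Intvl) : Intvl := ⟨J.center - a * J.len / 2, a * J.len⟩

/-- The dyadic interval `[m 2^j, (m + 1) 2^j)`. -/
def dyadic (j m : ℤ) : Intvl := ⟨(m : ℝ) * (2 : ℝ) ^ j, (2 : ℝ) ^ j⟩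

end Intvl

/-- A line of the plane that is not parallel to the vertical axis: the graph of
`z ↦ c + 2 b z`. -/
structure Line where
  c : ℝ
  b : ℝ

/-- The height of the line above `z`. -/
def Line.eval (l : Line) (z : ℝ) : ℝ := l.c + 2 * l.b * z

/-- `dist^A (l₁, l₂) = sup_{x ∈ A} |l₁(x) - l₂(x)|` (used for bounded nonempty `A`). -/
def lineDist (A : Set ℝ) (l₁ l₂ : Line) : ℝ :=
  sSup ((fun x => |l₁.eval x - l₂.eval x|) '' A)

/-- A triple `[α, ω, I] = [left, right, time]` of intervals, thought of as the parallelogram whose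
left vertical edge is `α` (above the left endpoint of `I`) and whose right vertical edge is `ω`
(above the right endpoint of `I`). Tiles and their dilates are of this kind. -/
structure Box where
  left : Intvl
  right : Intvl
  time : Intvl

namespace Box

/-- `a [α, ω, I] = [a α, a ω, I]`. -/
def dilate (a : ℝ) (P : Box) : Box := ⟨P.left.dilate a, P.right.dilate a, P.time⟩

/-- `l ∈ P`: the line `l` meets both vertical edges of `P`. -/
def HasLine (P : Box) (l : Line) : Prop :=
  l.eval P.time.lo ∈ P.left.toSet ∧ l.eval P.time.hi ∈ P.right.toSet

/-- `P₁ ≤ P₂`: `I₁ ⊆ I₂` and some line belongs to both `P₂` and `P₁`. -/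
def Le (P₁ P₂ : Box) : Prop :=
  P₁.time.toSet ⊆ P₂.time.toSet ∧ ∃ l : Line, P₂.HasLine l ∧ P₁.HasLine l

/-- `inf_{l₁ ∈ P₁, l₂ ∈ P₂} dist^{I₂} (l₁, l₂) / |ω₂|`. -/
def deltaAux (P₁ P₂ : Box) : ℝ :=
  sInf {d : ℝ | ∃ l₁ l₂ : Line, P₁.HasLine l₁ ∧ P₂.HasLine l₂ ∧
    d = lineDist P₂.time.toSet l₁ l₂} / P₂.right.len

/-- `Δ(P₁, P₂)`: the preceding quantity, the second box being the one with the shorter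
time interval. -/
def delta (P₁ P₂ : Box) : ℝ :=
  if P₂.time.len ≤ P₁.time.len then deltaAux P₁ P₂ else deltaAux P₂ P₁

end Box

/-- `⌈x⌉ = 1 / (1 + |x|)`. -/
def bracket (x : ℝ) : ℝ := 1 / (1 + |x|)

/-- A tile `[α, ω, I]`: `I = [i 2^{-k}, (i + 1) 2^{-k}) ⊆ [0, 1)` with `k ≥ 0`, and
`α = [u 2^k, (u + 1) 2^k)`, `ω = [v 2^k, (v + 1) 2^k)` arbitrary dyadic intervals of
length `|I|⁻¹ = 2^k`. -/
@[ext]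
structure Tile where
  k : ℕ
  i : ℤ
  u : ℤ
  v : ℤ
  i_nonneg : 0 ≤ i
  i_lt : i < 2 ^ k

namespace Tile

/-- The triple of intervals of a tile. -/
def box (P : Tile) : Box :=
  ⟨Intvl.dyadic P.k P.u, Intvl.dyadic P.k P.v, Intvl.dyadic (-(P.k : ℤ)) P.i⟩

/-- The time interval of a tile. -/
def I (P : Tile) : Set ℝ := P.box.time.toSet

/-- The relation `P₁ ≤ P₂` between tiles. -/
def Le (P₁ P₂ : Tile) : Prop := P₁.box.Le P₂.box

end Tile

/-- The tiles whose time interval has length `2^{-k}` with `k ≡ r` modulo `M`. All tiles are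
obtained for `M = 1`. -/
def sparseTiles (M r : ℕ) : Set Tile := {P | P.k ≡ r [MOD M]}

/-- `E(P) = {x ∈ I : l_x ∈ P}`, where `l_x(z) = c(x) + 2 b(x) z`. -/
def tileE (c b : ℝ → ℝ) (P : Tile) : Set ℝ := {x | x ∈ P.I ∧ P.box.HasLine ⟨c x, b x⟩}

/-- The mass of `P` relative to the collection `ℙ` of tiles:
`A(P) = sup_{P' ∈ ℙ, I ⊆ I'} |E(P')| / |I'| ⌈Δ(2P, 2P')⌉^N`. The terms lie in `[0, 1]`. -/
def mass (ℙ : Set Tile) (N : ℕ) (c b : ℝ → ℝ) (P : Tile) : ℝ :=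
  sSup {t : ℝ | ∃ P' ∈ ℙ, P.I ⊆ P'.I ∧
    t = volume.real (tileE c b P') / volume.real P'.I *
      bracket (Box.delta (P.box.dilate 2) (P'.box.dilate 2)) ^ N}

/-- `ψ_k(y) = 2^k ψ(2^k y)`. -/
def psiScale (ψ : ℝ → ℝ) (k : ℕ) (y : ℝ) : ℝ := 2 ^ k * ψ (2 ^ k * y)

/-- The square-integrable functions on the circle `𝕋 = ℝ / ℤ`, that is, the 1-periodic ones. -/
abbrev L2T : Type := Lp ℂ 2 (volume : Measure UnitAddCircle)

/-- `T_P f(x) = (∫_{-1/2}^{1/2} e^{i (l_x(x) y - b(x) y²)} ψ_k(y) f(x - y) dy) χ_{E(P)}(x)`,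
for a 1-periodic `f`. -/
def tileOp (ψ c b : ℝ → ℝ) (P : Tile) (f : UnitAddCircle → ℂ) (x : ℝ) : ℂ :=
  (tileE c b P).indicator
    (fun x => ∫ y in (-(1 / 2) : ℝ)..(1 / 2),
      Complex.exp (Complex.I * (((Line.eval ⟨c x, b x⟩ x) * y - b x * y ^ 2 : ℝ) : ℂ)) *
        ((psiScale ψ P.k y : ℝ) : ℂ) * f ((x - y : ℝ) : UnitAddCircle)) x

/-- `S` is the operator `T^𝒬 = ∑_{P ∈ 𝒬} T_P` on `L²(𝕋)`: for every `f`, the series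
`∑_{P ∈ 𝒬} T_P f(x)` converges to `S f(x)` for almost every `x ∈ [0, 1)`. -/
def IsFamilyOp (ψ c b : ℝ → ℝ) (𝒬 : Set Tile) (S : L2T →L[ℂ] L2T) : Prop :=
  ∀ f : L2T, ∀ᵐ x ∂(volume.restrict (Ico (0 : ℝ) 1)),
    HasSum (fun P : 𝒬 => tileOp ψ c b P f x) (S f (x : UnitAddCircle))

end QuadCarleson

end

open QuadCarleson

/-! Incomparability makes the sets E(P) pairwise disjoint: a point x common to two of them gives
nested time intervals and the common line l_x (`le_or_le_of_mem_tileE`). So at each x at most one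
T_P acts, and the family is a single integral operator, `kernel`, whose scale k(x) depends on x. Its
norm is estimated through TT* (`lintegral_enorm_integral_sq_le`), that is, through the correlation
of `kernel` at two points x, x'.

The y-derivative of the phase at x is -l_x(y), so the correlation oscillates with frequency l_{x'} -
l_x. Let k(x') ≤ k(x). The supports overlap only if |x - x'| ≤ 10·2^{-k(x')}, the correlation is
O(2^{k(x')}), and van der Corput gains K^{-1/2} unless the two lines are within K tile heights at
the scale of x (`CloseAt`). Small mass makes such exceptional x rare: over a dyadic interval, lines
close to l_{x'} pass through O((1+K)^2) tiles, each with |E| ≤ (1+K)^N δ |I|. A stopping argument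
over the scales (`IsCloseSet.volume_inter_le`) then bounds the exceptional set by θ 2^{-k(x')}, with
θ a multiple of 2^M (1+K)^{N+2} δ.

Hölder with exponents 3 and 3/2 turns the small measure into θ^{1/3} times an L^{3/2} average around
x', and the maximal function of such averages is bounded on L² (`lintegral_mul_ballAvg_rpow_le`).
Hence ‖T‖² is at most a constant times K^{-1/2} + θ^{1/3}. Taking K = δ^{-1/(2(N+2))} makes θ =
O(δ^{1/2}) and the squared norm O(δ^{1/(4(N+2))}). -/

/-! ### Van der Corput's estimate for quadratic phases. -/

namespace QuadCarleson

-- Up to the sign of B, an antiderivative is arctan((A + B s)/l)/l, and arctan varies by less than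
-- π. The bound is independent of A, B and of the interval.
open Real in
lemma integral_abs_div_sq_add_sq_le {l : ℝ} (hl : 0 < l) (A B u v : ℝ) :
    ∫ s in u..v, |B| / (l ^ 2 + (A + B * s) ^ 2) ≤ π / l := by
  have hpos : ∀ s, 0 < l ^ 2 + (A + B * s) ^ 2 := fun s => by positivity
  have hcont : ∀ D : ℝ, Continuous fun s : ℝ => D / (l ^ 2 + (A + B * s) ^ 2) := fun D =>
    continuous_const.div (by fun_prop) fun s => (hpos s).ne'
  have key : ∫ s in u..v, B / (l ^ 2 + (A + B * s) ^ 2)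
      = (1 / l) * arctan ((A + B * v) / l) - (1 / l) * arctan ((A + B * u) / l) := by
    refine intervalIntegral.integral_eq_sub_of_hasDerivAt
      (f := fun s => (1 / l) * arctan ((A + B * s) / l)) (fun s _ => ?_)
      ((hcont B).intervalIntegrable _ _)
    have h1 : HasDerivAt (fun s : ℝ => (A + B * s) / l) (B / l) s := by
      simpa using (((hasDerivAt_id s).const_mul B).const_add A).div_const l
    convert! (h1.arctan.const_mul (1 / l)) using 1
    have := hpos s
    field_simp
  have hb : ∀ t s : ℝ, (1 / l) * arctan t - (1 / l) * arctan s ≤ π / l := fun t s => by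
    rw [← mul_sub, one_div, div_eq_inv_mul]
    have := arctan_lt_pi_div_two t
    have := neg_pi_div_two_lt_arctan s
    gcongr
    linarith
  rcases abs_choice B with h | h
  · rw [h, key]
    exact hb _ _
  · rw [h]
    have : ∀ s, -B / (l ^ 2 + (A + B * s) ^ 2) = -(B / (l ^ 2 + (A + B * s) ^ 2)) := fun s => by
      ring
    simp_rw [this]
    rw [intervalIntegral.integral_neg, key, neg_sub]
    exact hb _ _

/-- The sublevel set bound for an affine function, in smooth form. -/
lemma integral_sq_div_sq_add_sq_le {l A B : ℝ} (hl : 1 ≤ l) (hL : l ^ 2 = |A| + 5 * |B|) :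
    ∫ s in (-5 : ℝ)..5, l ^ 2 / (l ^ 2 + (A + B * s) ^ 2) ≤ 104 / l := by
  have hl0 : 0 < l := by linarith
  have hpos : ∀ s, 0 < l ^ 2 + (A + B * s) ^ 2 := fun s => by positivity
  -- If the slope carries a fixed share of l², the arctangent bound applies. Otherwise 5|B| < l²/4,
  -- so |A + B s| ≥ l² - 10|B| ≥ l²/2 on [-5, 5] and there is no zero nearby.
  rcases le_or_gt (l ^ 2) (20 * |B|) with h | h
  · have hB : 0 < |B| := by nlinarith
    have : ∀ s, l ^ 2 / (l ^ 2 + (A + B * s) ^ 2)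
        = (l ^ 2 / |B|) * (|B| / (l ^ 2 + (A + B * s) ^ 2)) := fun s => by
      field_simp
    simp_rw [this]
    rw [intervalIntegral.integral_const_mul]
    calc l ^ 2 / |B| * _ ≤ 20 * (Real.pi / l) := by
          refine mul_le_mul ((div_le_iff₀ hB).2 h) (integral_abs_div_sq_add_sq_le hl0 ..) ?_
            (by norm_num)
          exact intervalIntegral.integral_nonneg (by norm_num) fun s _ => by
            have := hpos s; positivity
      _ ≤ 104 / l := by
          rw [← mul_div_assoc]
          gcongr
          linarith [Real.pi_lt_d2]
  · have hb : ∀ s ∈ Icc (-5 : ℝ) 5, l ^ 2 / (l ^ 2 + (A + B * s) ^ 2) ≤ 4 / l := by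
      intro s hs
      have h1 : |A| - 5 * |B| ≤ |A + B * s| := by
        have h2 : |B * s| ≤ 5 * |B| := by
          rw [abs_mul, mul_comm]
          gcongr
          exact abs_le.2 hs
        have h3 : |A| ≤ |A + B * s| + |B * s| := by
          simpa using abs_sub (A + B * s) (B * s)
        linarith
      have h4 : l ^ 2 / 2 ≤ |A + B * s| := by linarith
      have h5 : (l ^ 2 / 2) ^ 2 ≤ (A + B * s) ^ 2 := by
        rw [← sq_abs (A + B * s)]
        gcongr
      rw [div_le_div_iff₀ (hpos s) hl0]
      have h6 : l ^ 3 ≤ l ^ 4 := pow_le_pow_right₀ hl (by norm_num)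
      nlinarith
    calc _ ≤ ∫ s in (-5 : ℝ)..5, 4 / l := by
          refine intervalIntegral.integral_mono_on (by norm_num) ?_ (by simp) hb
          exact (continuous_const.div (by fun_prop) fun s => (hpos s).ne').intervalIntegrable _ _
      _ = 40 / l := by simp; ring
      _ ≤ 104 / l := by gcongr; norm_num

open Complex in
/-- Van der Corput's estimate for a quadratic phase and a `C¹` amplitude. -/
lemma norm_integral_exp_quadratic_le {a a' : ℝ → ℝ} {D A B L : ℝ}
    (ha : ∀ s, HasDerivAt a (a' s) s) (ha' : Continuous a') (hm : a (-5) = 0) (hp : a 5 = 0)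
    (hD : ∀ s, |a s| ≤ D) (hD' : ∀ s, |a' s| ≤ D) (hL1 : 1 ≤ L) (hL : L ≤ |A| + 5 * |B|) :
    ‖∫ s in (-5 : ℝ)..5, exp (I * ((A * s + B * s ^ 2 / 2 : ℝ) : ℂ)) * (a s : ℂ)‖
      ≤ 120 * D / √L := by
  have hD0 : 0 ≤ D := (abs_nonneg _).trans (hD 0)
  set L' := |A| + 5 * |B|
  set l := √L' with hl
  have hl2 : l ^ 2 = L' := Real.sq_sqrt (by positivity)
  have hl1 : 1 ≤ l := Real.one_le_sqrt.2 (hL1.trans hL)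
  have hl0 : 0 < l := by linarith
  set q : ℝ → ℝ := fun s => A + B * s with hq
  have hpos : ∀ s, 0 < l ^ 2 + q s ^ 2 := fun s => by positivity
  have hac : Continuous a := continuous_iff_continuousAt.2 fun s => (ha s).continuousAt
  have hqc : Continuous q := by fun_prop
  -- A regularised form of a/q, where q is the derivative of the phase: it stays smooth at the
  -- stationary point, so the integral need not be split there. The error a - q w = a l²/(l² + q²)
  -- lives where |q| is at most about l and is handled by the sublevel bound.
  set w : ℝ → ℝ := fun s => a s * q s / (l ^ 2 + q s ^ 2) with hw
  set w' : ℝ → ℝ := fun s => a' s * (q s / (l ^ 2 + q s ^ 2))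
    + a s * (B * (l ^ 2 - q s ^ 2) / (l ^ 2 + q s ^ 2) ^ 2) with hw'
  have hwd : ∀ s, HasDerivAt w (w' s) s := by
    intro s
    have h1 : HasDerivAt q B s := by
      convert! ((hasDerivAt_id s).const_mul B).const_add A using 1
      simp
    have h2 : HasDerivAt (fun s => l ^ 2 + q s ^ 2) (2 * q s * B) s := by
      simpa using (h1.pow 2).const_add (l ^ 2)
    convert! ((ha s).mul h1).div h2 (hpos s).ne' using 1
    have := hpos s
    simp only [hw', Pi.mul_apply]
    field_simp
    ring
  have hwc : Continuous w := continuous_iff_continuousAt.2 fun s => (hwd s).continuousAt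
  have hw'c : Continuous w' := by
    refine (ha'.mul (hqc.div (by fun_prop) fun s => (hpos s).ne')).add
      (hac.mul (Continuous.div (by fun_prop) (by fun_prop) fun s => (pow_pos (hpos s) 2).ne'))
  set e : ℝ → ℂ := fun s => exp (I * ((A * s + B * s ^ 2 / 2 : ℝ) : ℂ)) with he
  have hed : ∀ s, HasDerivAt e (e s * (I * (q s : ℂ))) s := by
    intro s
    have h1 : HasDerivAt (fun s : ℝ => A * s + B * s ^ 2 / 2) (q s) s := by
      have := ((hasDerivAt_id s).const_mul A).add
        ((((hasDerivAt_id s).pow 2).const_mul B).div_const 2)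
      convert! this using 1
      simp [hq]
      ring
    exact (h1.ofReal_comp.const_mul I).cexp
  have hec : Continuous e := continuous_iff_continuousAt.2 fun s => (hed s).continuousAt
  have hen : ∀ s, ‖e s‖ = 1 := fun s => by
    rw [he]
    simp only
    rw [mul_comm]
    exact norm_exp_ofReal_mul_I _
  -- integration by parts
  have ibp : ∫ s in (-5 : ℝ)..5, (e s * (I * (q s : ℂ)) * (w s : ℂ) + e s * (w' s : ℂ)) = 0 := by
    rw [intervalIntegral.integral_eq_sub_of_hasDerivAt
      (f := fun s => e s * (w s : ℂ)) (fun s _ => (hed s).mul (hwd s).ofReal_comp)]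
    · simp [hw, hm, hp]
    · exact Continuous.intervalIntegrable (by fun_prop) _ _
  -- The last bracket is (e w)', which integrates to zero because a vanishes at ±5.
  have split : ∀ s, e s * (a s : ℂ) = e s * ((a s * (l ^ 2 / (l ^ 2 + q s ^ 2)) : ℝ) : ℂ)
      + I * (e s * (w' s : ℂ))
      + (-I) * (e s * (I * (q s : ℂ)) * (w s : ℂ) + e s * (w' s : ℂ)) := by
    intro s
    have h1 : a s = a s * (l ^ 2 / (l ^ 2 + q s ^ 2)) + q s * w s := by
      have := hpos s
      simp only [hw]
      field_simp
    have h2 : (a s : ℂ) = ((a s * (l ^ 2 / (l ^ 2 + q s ^ 2)) : ℝ) : ℂ) + (q s : ℂ) * (w s : ℂ) := by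
      exact_mod_cast h1
    rw [h2]
    linear_combination ((q s : ℂ) * (w s : ℂ) * e s) * I_mul_I
  have hrc : Continuous fun s => l ^ 2 / (l ^ 2 + q s ^ 2) :=
    continuous_const.div (by fun_prop) fun s => (hpos s).ne'
  have hsc : Continuous fun s => |B| / (l ^ 2 + q s ^ 2) :=
    continuous_const.div (by fun_prop) fun s => (hpos s).ne'
  have eq1 : ∫ s in (-5 : ℝ)..5, e s * (a s : ℂ) =
      ∫ s in (-5 : ℝ)..5, (e s * ((a s * (l ^ 2 / (l ^ 2 + q s ^ 2)) : ℝ) : ℂ)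
        + I * (e s * (w' s : ℂ))) := by
    rw [intervalIntegral.integral_congr fun s _ => split s, intervalIntegral.integral_add,
      intervalIntegral.integral_const_mul, ibp, mul_zero, add_zero]
    · exact Continuous.intervalIntegrable (by fun_prop) _ _
    · exact Continuous.intervalIntegrable (by fun_prop) _ _
  rw [eq1]
  have bd : ∀ s, ‖e s * ((a s * (l ^ 2 / (l ^ 2 + q s ^ 2)) : ℝ) : ℂ) + I * (e s * (w' s : ℂ))‖
      ≤ D * (l ^ 2 / (l ^ 2 + q s ^ 2) + (1 / l + |B| / (l ^ 2 + q s ^ 2))) := by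
    intro s
    have := hpos s
    refine (norm_add_le _ _).trans ?_
    rw [norm_mul, norm_mul, norm_mul, hen, norm_I, one_mul, one_mul, one_mul, norm_real, norm_real,
      mul_add]
    gcongr
    · rw [norm_mul]
      refine mul_le_mul (hD s) (le_of_eq ?_) (norm_nonneg _) hD0
      rw [Real.norm_of_nonneg (by positivity)]
    · refine (norm_add_le _ _).trans ?_
      rw [norm_mul, norm_mul, mul_add]
      refine add_le_add (mul_le_mul (hD' s) ?_ (norm_nonneg _) hD0)
        (mul_le_mul (hD s) ?_ (norm_nonneg _) hD0)
      · rw [Real.norm_eq_abs, abs_div, abs_of_pos (hpos s), div_le_div_iff₀ (hpos s) hl0]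
        nlinarith [sq_nonneg (l - |q s|), sq_abs (q s), abs_nonneg (q s)]
      · rw [Real.norm_eq_abs, abs_div, abs_mul, abs_of_pos (pow_pos (hpos s) 2),
          div_le_div_iff₀ (pow_pos (hpos s) 2) (hpos s)]
        have h1 : |l ^ 2 - q s ^ 2| ≤ l ^ 2 + q s ^ 2 :=
          abs_le.2 ⟨by nlinarith [sq_nonneg l], by nlinarith [sq_nonneg (q s)]⟩
        calc _ ≤ |B| * (l ^ 2 + q s ^ 2) * (l ^ 2 + q s ^ 2) := by gcongr
          _ = _ := by ring
  calc _ ≤ ∫ s in (-5 : ℝ)..5,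
        D * (l ^ 2 / (l ^ 2 + q s ^ 2) + (1 / l + |B| / (l ^ 2 + q s ^ 2))) :=
        intervalIntegral.norm_integral_le_of_norm_le (by norm_num)
          (Filter.Eventually.of_forall fun s _ => bd s)
          (Continuous.intervalIntegrable (by fun_prop) _ _)
    _ = D * ((∫ s in (-5 : ℝ)..5, l ^ 2 / (l ^ 2 + q s ^ 2)) + (10 * (1 / l)
        + ∫ s in (-5 : ℝ)..5, |B| / (l ^ 2 + q s ^ 2))) := by
        rw [intervalIntegral.integral_const_mul, intervalIntegral.integral_add,
          intervalIntegral.integral_add, intervalIntegral.integral_const]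
        · norm_num
        · simp
        · exact hsc.intervalIntegrable _ _
        · exact hrc.intervalIntegrable _ _
        · exact Continuous.intervalIntegrable (by fun_prop) _ _
    _ ≤ D * (104 / l + (10 * (1 / l) + Real.pi / l)) := by
        gcongr
        · exact integral_sq_div_sq_add_sq_le hl1 hl2
        · exact integral_abs_div_sq_add_sq_le hl0 ..
    _ = D * (114 + Real.pi) / l := by ring
    _ ≤ D * 120 / √L := by
        have : √L ≤ l := Real.sqrt_le_sqrt hL
        have : 0 < √L := Real.sqrt_pos.2 (by linarith)
        gcongr
        linarith [Real.pi_lt_four]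
    _ = 120 * D / √L := by ring

end QuadCarleson

/-! ### Maximal averages with a radius chosen at each point. -/

namespace QuadCarleson

open scoped ENNReal
open Metric

/-- The average (up to a factor `2`) of `h` over the interval of radius `ρ x` centred at `x`. -/
noncomputable def ballAvg (ρ : ℝ → ℝ) (h : ℝ → ℝ≥0∞) (x : ℝ) : ℝ≥0∞ :=
  (∫⁻ t in closedBall x (ρ x), h t) / ENNReal.ofReal (ρ x)

variable {ρ : ℝ → ℝ} {h : ℝ → ℝ≥0∞}

lemma measurable_ballAvg (hρ : Measurable ρ) (hh : Measurable h) :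
    Measurable (ballAvg ρ h) := by
  have hs : MeasurableSet {z : ℝ × ℝ | dist z.2 z.1 ≤ ρ z.1} :=
    measurableSet_le (by fun_prop) (by fun_prop)
  have : ∀ x, (∫⁻ t in closedBall x (ρ x), h t)
      = ∫⁻ t, ({z : ℝ × ℝ | dist z.2 z.1 ≤ ρ z.1}.indicator fun z => h z.2) (x, t) := fun x => by
    rw [← lintegral_indicator measurableSet_closedBall]
    rfl
  unfold ballAvg
  simp_rw [this]
  refine Measurable.div ?_ (by fun_prop)
  exact Measurable.lintegral_prod_right' ((hh.comp measurable_snd).indicator hs)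

/-- The weak type `(1, 1)` inequality. -/
lemma volume_lt_ballAvg_le {R : ℝ} (hρ0 : ∀ x, 0 < ρ x) (hρR : ∀ x, ρ x ≤ R)
    {l : ℝ≥0∞} (hl0 : l ≠ 0) (hl : l ≠ ∞) :
    volume {x | l < ballAvg ρ h x} ≤ 8 / l * ∫⁻ t, h t := by
  -- Any enlargement factor above 3 would do. The bound R on the radii is needed for the selection
  -- only and does not enter the constant 8 = 2 · 4.
  obtain ⟨u, hut, hdisj, hcov⟩ := Vitali.exists_disjoint_subfamily_covering_enlargement_closedBall
    {x | l < ballAvg ρ h x} id ρ R (fun x _ => hρR x) 4 (by norm_num)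
  simp only [id] at hdisj hcov
  have hcount : u.Countable := by
    refine hdisj.countable_of_nonempty_interior fun x _ => ?_
    exact ⟨x, ball_subset_interior_closedBall (mem_ball_self (hρ0 x))⟩
  calc volume {x | l < ballAvg ρ h x} ≤ volume (⋃ x ∈ u, closedBall x (4 * ρ x)) := by
        refine measure_mono fun x hx => ?_
        obtain ⟨y, hy, hsub⟩ := hcov x hx
        exact mem_biUnion hy (hsub (mem_closedBall_self (hρ0 x).le))
    _ ≤ ∑' x : u, volume (closedBall (x : ℝ) (4 * ρ x)) := measure_biUnion_le _ hcount _
    _ ≤ ∑' x : u, 8 / l * ∫⁻ t in closedBall (x : ℝ) (ρ x), h t := by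
        refine ENNReal.tsum_le_tsum fun x => ?_
        have hx := hut x.2
        have h1 : l * ENNReal.ofReal (ρ x) ≤ ∫⁻ t in closedBall (x : ℝ) (ρ x), h t :=
          (ENNReal.le_div_iff_mul_le (Or.inl (by simpa using hρ0 x)) (Or.inl (by simp))).1 hx.le
        rw [Real.volume_closedBall, show 2 * (4 * ρ x) = 8 * ρ x by ring,
          ENNReal.ofReal_mul (by norm_num), ENNReal.ofReal_ofNat]
        calc (8 : ℝ≥0∞) * ENNReal.ofReal (ρ x) = 8 / l * (l * ENNReal.ofReal (ρ x)) := by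
              rw [← mul_assoc, ENNReal.div_mul_cancel hl0 hl]
          _ ≤ _ := by gcongr
    _ = 8 / l * ∑' x : u, ∫⁻ t in closedBall (x : ℝ) (ρ x), h t := ENNReal.tsum_mul_left
    _ = 8 / l * ∫⁻ t in ⋃ x ∈ u, closedBall x (ρ x), h t := by
        rw [lintegral_biUnion hcount (fun _ _ => measurableSet_closedBall) hdisj]
    _ ≤ _ := by gcongr; exact Measure.restrict_le_self

/-- The truncation step of Marcinkiewicz interpolation. The bounded part contributes 2s rather than
s, since the ball has length 2ρ while the average divides by ρ. -/
lemma ballAvg_le_add {g : ℝ → ℝ≥0∞} (hg : Measurable g) (hρ0 : ∀ x, 0 < ρ x) {s : ℝ}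
    (hs : 0 ≤ s) (hhg : ∀ t, h t ≤ g t + ENNReal.ofReal s) (x : ℝ) :
    ballAvg ρ h x ≤ ballAvg ρ g x + ENNReal.ofReal (2 * s) := by
  have hx := hρ0 x
  have h2 : ENNReal.ofReal (2 * s)
      = (∫⁻ _ in closedBall x (ρ x), ENNReal.ofReal s) / ENNReal.ofReal (ρ x) := by
    rw [setLIntegral_const, Real.volume_closedBall, ← ENNReal.ofReal_mul hs,
      ← ENNReal.ofReal_div_of_pos hx]
    congr 1
    field_simp
  rw [h2, ballAvg, ballAvg, ← ENNReal.add_div, ← lintegral_add_left hg]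
  gcongr with t
  exact hhg t

/-- The strong type inequality for the exponent `4 / 3`. -/
lemma lintegral_ballAvg_rpow_le {R B : ℝ} (hρ : Measurable ρ) (hρ0 : ∀ x, 0 < ρ x)
    (hρR : ∀ x, ρ x ≤ R) {f : ℝ → ℝ} (hf : Measurable f) (hf0 : ∀ x, 0 ≤ f x)
    (hfB : ∀ x, f x ≤ B) :
    ∫⁻ x, ballAvg ρ (fun t => ENNReal.ofReal (f t)) x ^ (4 / 3 : ℝ)
      ≤ 128 * ∫⁻ x, ENNReal.ofReal (f x) ^ (4 / 3 : ℝ) := by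
  set V := ballAvg ρ (fun t => ENNReal.ofReal (f t)) with hV
  have hVm : Measurable V := measurable_ballAvg hρ (by fun_prop)
  have hB0 : 0 ≤ B := (hf0 0).trans (hfB 0)
  have hVfin : ∀ x, V x ≠ ∞ := fun x => by
    have := ballAvg_le_add (g := 0) (h := fun t => ENNReal.ofReal (f t)) measurable_const hρ0 hB0
      (fun t => by simpa using ENNReal.ofReal_le_ofReal (hfB t)) x
    refine ne_top_of_le_ne_top ?_ this
    simpa [ballAvg] using ENNReal.mul_ne_top ENNReal.ofNat_ne_top ENNReal.ofReal_ne_top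
  -- The part of f below t/4 contributes at most t/2 to V, so the rest must exceed t/2; the weak
  -- bound at level t/2 gives 8/(t/2) = 16/t.
  have hlev : ∀ t : ℝ, 0 < t → volume {x | t < (V x).toReal}
      ≤ ENNReal.ofReal (16 / t) * ∫⁻ x, {x | t < 4 * f x}.indicator
        (fun x => ENNReal.ofReal (f x)) x := by
    intro t ht
    set g : ℝ → ℝ≥0∞ := {x | t < 4 * f x}.indicator (fun x => ENNReal.ofReal (f x)) with hg
    have hgm : Measurable g :=
      Measurable.indicator (by fun_prop) (measurableSet_lt (by fun_prop) (by fun_prop))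
    have hsub : {x | t < (V x).toReal} ⊆ {x | ENNReal.ofReal (t / 2) < ballAvg ρ g x} := by
      intro x hx
      have h1 : ENNReal.ofReal t < V x := (ENNReal.ofReal_lt_iff_lt_toReal ht.le (hVfin x)).2 hx
      have h2 : V x ≤ ballAvg ρ g x + ENNReal.ofReal (2 * (t / 4)) := by
        refine ballAvg_le_add hgm hρ0 (by positivity) (fun y => ?_) x
        by_cases hy : t < 4 * f y
        · simp [hg, hy]
        · have : g y = 0 := by simp [hg, hy]
          rw [this, zero_add]
          exact ENNReal.ofReal_le_ofReal (by linarith)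
      have h3 : ENNReal.ofReal t = ENNReal.ofReal (t / 2) + ENNReal.ofReal (2 * (t / 4)) := by
        rw [← ENNReal.ofReal_add (by positivity) (by positivity)]
        congr 1; ring
      rw [h3] at h1
      exact lt_of_add_lt_add_right (h1.trans_le h2)
    refine (measure_mono hsub).trans ((volume_lt_ballAvg_le hρ0 hρR (by simpa using ht)
      (by simp)).trans_eq ?_)
    rw [← ENNReal.ofReal_ofNat 8, ← ENNReal.ofReal_div_of_pos (by positivity)]
    congr 2
    field_simp
    norm_num
  have hinner : ∀ x, ∫⁻ t in Ioi (0 : ℝ), (Iio (4 * f x)).indicator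
      (fun t => ENNReal.ofReal (t ^ (-(2 / 3) : ℝ))) t
      = ENNReal.ofReal (3 * (4 * f x) ^ (1 / 3 : ℝ)) := by
    intro x
    have h4 : 0 ≤ 4 * f x := by have := hf0 x; positivity
    rw [setLIntegral_indicator measurableSet_Iio, Iio_inter_Ioi, setLIntegral_congr Ioo_ae_eq_Ioc,
      ← ofReal_integral_eq_lintegral_ofReal]
    · rw [← intervalIntegral.integral_of_le h4, integral_rpow (Or.inl (by norm_num))]
      congr 1
      norm_num
      ring
    · rw [← IntegrableOn, ← intervalIntegrable_iff_integrableOn_Ioc_of_le h4]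
      exact intervalIntegral.intervalIntegrable_rpow' (by norm_num)
    · filter_upwards [ae_restrict_mem measurableSet_Ioc] with t ht
      exact Real.rpow_nonneg ht.1.le _
  calc ∫⁻ x, V x ^ (4 / 3 : ℝ) = ∫⁻ x, ENNReal.ofReal ((V x).toReal ^ (4 / 3 : ℝ)) := by
        refine lintegral_congr fun x => ?_
        rw [ENNReal.toReal_rpow, ENNReal.ofReal_toReal]
        exact ENNReal.rpow_ne_top_of_nonneg (by norm_num) (hVfin x)
    _ = ENNReal.ofReal (4 / 3) * ∫⁻ t in Ioi (0 : ℝ),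
          volume {x | t < (V x).toReal} * ENNReal.ofReal (t ^ (4 / 3 - 1 : ℝ)) :=
        lintegral_rpow_eq_lintegral_meas_lt_mul _ (Filter.Eventually.of_forall fun _ => by simp)
          (by fun_prop) (by norm_num)
    _ ≤ ENNReal.ofReal (4 / 3) * ∫⁻ t in Ioi (0 : ℝ), ∫⁻ x, 16 * ENNReal.ofReal (f x) *
          (Iio (4 * f x)).indicator (fun t => ENNReal.ofReal (t ^ (-(2 / 3) : ℝ))) t := by
        refine mul_le_mul_right (setLIntegral_mono' measurableSet_Ioi fun t ht => ?_) _
        have ht : 0 < t := ht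
        refine (mul_le_mul_left (hlev t ht) _).trans_eq ?_
        have : ENNReal.ofReal (16 / t) * ENNReal.ofReal (t ^ (4 / 3 - 1 : ℝ))
            = 16 * ENNReal.ofReal (t ^ (-(2 / 3) : ℝ)) := by
          have h1 : t ^ (-(2 / 3) : ℝ) = t ^ (4 / 3 - 1 : ℝ) / t := by
            rw [← Real.rpow_sub_one ht.ne']
            norm_num
          rw [← ENNReal.ofReal_mul (by positivity), ← ENNReal.ofReal_ofNat 16,
            ← ENNReal.ofReal_mul (by norm_num), h1]
          congr 1
          ring
        rw [mul_right_comm, this, ← lintegral_const_mul]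
        · refine lintegral_congr fun x => ?_
          by_cases hx : t < 4 * f x
          · simp [hx]; ring
          · simp [hx]
        · exact Measurable.indicator (by fun_prop) (measurableSet_lt (by fun_prop) (by fun_prop))
    _ = ENNReal.ofReal (4 / 3) * ∫⁻ x, ∫⁻ t in Ioi (0 : ℝ), 16 * ENNReal.ofReal (f x) *
          (Iio (4 * f x)).indicator (fun t => ENNReal.ofReal (t ^ (-(2 / 3) : ℝ))) t := by
        congr 1
        rw [lintegral_lintegral_swap]
        refine Measurable.aemeasurable (Measurable.mul (by fun_prop) ?_)
        have : (fun z : ℝ × ℝ => (Iio (4 * f z.2)).indicator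
            (fun t => ENNReal.ofReal (t ^ (-(2 / 3) : ℝ))) z.1)
            = {z : ℝ × ℝ | z.1 < 4 * f z.2}.indicator
              fun z => ENNReal.ofReal (z.1 ^ (-(2 / 3) : ℝ)) := rfl
        exact this ▸ Measurable.indicator (by fun_prop)
          (measurableSet_lt (by fun_prop) (by fun_prop))
    _ ≤ ENNReal.ofReal (4 / 3) * ∫⁻ x, 96 * ENNReal.ofReal (f x) ^ (4 / 3 : ℝ) := by
        gcongr with x
        rw [lintegral_const_mul _ (Measurable.indicator (by fun_prop) measurableSet_Iio), hinner,
          ENNReal.ofReal_rpow_of_nonneg (hf0 x) (by norm_num), ← ENNReal.ofReal_ofNat 16,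
          ← ENNReal.ofReal_ofNat 96, ← ENNReal.ofReal_mul (by norm_num),
          ← ENNReal.ofReal_mul (by have := hf0 x; positivity), ← ENNReal.ofReal_mul (by norm_num)]
        refine ENNReal.ofReal_le_ofReal ?_
        rw [Real.mul_rpow (by norm_num) (hf0 x), show (4 / 3 : ℝ) = 1 + 1 / 3 by norm_num,
          Real.rpow_add_of_nonneg (hf0 x) (by norm_num) (by norm_num), Real.rpow_one]
        have h4 : (4 : ℝ) ^ (1 / 3 : ℝ) ≤ 2 := by
          rw [show (4 : ℝ) = 2 ^ (2 : ℝ) by norm_num, ← Real.rpow_mul (by norm_num)]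
          exact (Real.rpow_le_rpow_of_exponent_le (by norm_num) (by norm_num)).trans_eq
            (Real.rpow_one 2)
        have h5 : 0 ≤ f x * f x ^ (1 / 3 : ℝ) :=
          mul_nonneg (hf0 x) (Real.rpow_nonneg (hf0 x) _)
        nlinarith
    _ = _ := by
        rw [lintegral_const_mul _ (by fun_prop), ← mul_assoc]
        congr 1
        rw [← ENNReal.ofReal_ofNat 96, ← ENNReal.ofReal_mul (by norm_num),
          ← ENNReal.ofReal_ofNat 128]
        norm_num

end QuadCarleson

/-! ### The TT* method. -/

namespace QuadCarleson

open scoped ENNReal ComplexConjugate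

lemma enorm_integral_mul_conj {X : Type*} [MeasurableSpace X] {μ : Measure X} {G : X → ℂ}
    (hG : MemLp G 2 μ) : ‖∫ x, G x * conj (G x) ∂μ‖ₑ = ∫⁻ x, ‖G x‖ₑ ^ 2 ∂μ := by
  have h1 : ∀ x, G x * conj (G x) = ((‖G x‖ ^ 2 : ℝ) : ℂ) := fun x => by
    rw [Complex.mul_conj, Complex.normSq_eq_norm_sq]
  simp_rw [h1]
  rw [integral_complex_ofReal, ← ofReal_norm, Complex.norm_real,
    Real.norm_of_nonneg (integral_nonneg fun x => by positivity),
    ofReal_integral_eq_lintegral_ofReal ((memLp_two_iff_integrable_sq_norm hG.1).1 hG)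
      (Filter.Eventually.of_forall fun x => by positivity)]
  refine lintegral_congr fun x => ?_
  rw [ENNReal.ofReal_pow (norm_nonneg _), ofReal_norm]

/-- The `TT*` argument: a bound for the quadratic form of the kernel of `T T*` gives a bound for
the `L²` norm of the integral operator `T`. -/
lemma lintegral_enorm_integral_sq_le {X Y : Type*} [MeasurableSpace X] [MeasurableSpace Y]
    {μ : Measure X} {ν : Measure Y} [IsFiniteMeasure μ] [IsFiniteMeasure ν]
    {K : X → Y → ℂ} (hK : Measurable (Function.uncurry K)) {B : ℝ} (hB : ∀ x y, ‖K x y‖ ≤ B)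
    {A : ℝ≥0∞}
    (hform : ∀ g : X → ℝ, Measurable g → (∀ x, 0 ≤ g x) → (∃ D, ∀ x, g x ≤ D) →
      ∫⁻ x, ∫⁻ x', ENNReal.ofReal (g x) * ENNReal.ofReal (g x') *
        ‖∫ y, K x y * conj (K x' y) ∂ν‖ₑ ∂μ ∂μ ≤ A * ∫⁻ x, ENNReal.ofReal (g x) ^ 2 ∂μ)
    {F : Y → ℂ} (hF : MemLp F 2 ν) :
    ∫⁻ x, ‖∫ y, K x y * F y ∂ν‖ₑ ^ 2 ∂μ ≤ A * ∫⁻ y, ‖F y‖ₑ ^ 2 ∂ν := by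
  wlog hFm : StronglyMeasurable F generalizing F
  · have hae := hF.1.ae_eq_mk
    have key := this (F := hF.1.mk F) ((memLp_congr_ae hae).1 hF) hF.1.stronglyMeasurable_mk
    have e1 : ∀ x, ∫ y, K x y * F y ∂ν = ∫ y, K x y * hF.1.mk F y ∂ν := fun x =>
      integral_congr_ae (hae.mono fun y hy => by simp only [hy])
    have e2 : ∫⁻ y, ‖F y‖ₑ ^ 2 ∂ν = ∫⁻ y, ‖hF.1.mk F y‖ₑ ^ 2 ∂ν :=
      lintegral_congr_ae (hae.mono fun y hy => by simp only [hy])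
    simpa only [e1, e2] using key
  have hFi : Integrable F ν := hF.integrable (by norm_num)
  have hKs : StronglyMeasurable (Function.uncurry K) := hK.stronglyMeasurable
  have hKx : ∀ x, StronglyMeasurable (K x) := fun x =>
    (hK.comp measurable_prodMk_left).stronglyMeasurable
  have hKy : ∀ y, StronglyMeasurable fun x => K x y := fun y =>
    (hK.comp measurable_prodMk_right).stronglyMeasurable
  set G : X → ℂ := fun x => ∫ y, K x y * F y ∂ν with hG
  have hGm : StronglyMeasurable G :=
    (hKs.mul (hFm.comp_measurable measurable_snd)).integral_prod_right
  set D := ∫ y, B * ‖F y‖ ∂ν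
  have hGD : ∀ x, ‖G x‖ ≤ D := fun x => by
    refine norm_integral_le_of_norm_le (hFi.norm.const_mul B)
      (Filter.Eventually.of_forall fun y => ?_)
    rw [norm_mul]
    gcongr
    exact hB x y
  have hG2 : MemLp G 2 μ := MemLp.of_bound hGm.aestronglyMeasurable D
    (Filter.Eventually.of_forall hGD)
  have hGi : Integrable G μ := hG2.integrable (by norm_num)
  set H : Y → ℂ := fun y => ∫ x, conj (K x y) * G x ∂μ with hH
  have hHm : StronglyMeasurable H := by
    have : StronglyMeasurable fun z : X × Y => conj (K z.1 z.2) * G z.1 :=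
      (Complex.continuous_conj.comp_stronglyMeasurable hKs).mul
        (hGm.comp_measurable measurable_fst)
    exact this.integral_prod_left
  have hHB : ∀ y, ‖H y‖ ≤ ∫ x, B * ‖G x‖ ∂μ := fun y => by
    refine norm_integral_le_of_norm_le (hGi.norm.const_mul B)
      (Filter.Eventually.of_forall fun x => ?_)
    rw [norm_mul, RCLike.norm_conj]
    gcongr
    exact hB x y
  have hH2 : MemLp H 2 ν := MemLp.of_bound hHm.aestronglyMeasurable _
    (Filter.Eventually.of_forall hHB)
  set a := ∫⁻ x, ‖G x‖ₑ ^ 2 ∂μ with ha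
  -- Finiteness comes from the crude bound `B` on the kernel; it is what allows cancelling a at the
  -- end.
  have hafin : a ≠ ∞ := by
    have := hG2.eLpNorm_lt_top
    rw [eLpNorm_lt_top_iff_lintegral_rpow_enorm_lt_top (by norm_num) (by norm_num)] at this
    simpa [ha] using this.ne
  -- duality
  have h1 : a = ‖∫ y, F y * conj (H y) ∂ν‖ₑ := by
    rw [ha, ← enorm_integral_mul_conj hG2]
    congr 1
    have e1 : ∀ x, G x * conj (G x) = ∫ y, K x y * F y * conj (G x) ∂ν := fun x => by
      rw [integral_mul_const]
    have e2 : ∀ y, F y * conj (H y) = ∫ x, K x y * F y * conj (G x) ∂μ := fun y => by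
      simp only [hH]
      rw [← integral_conj, ← integral_const_mul]
      refine integral_congr_ae (Filter.Eventually.of_forall fun x => ?_)
      simp only [map_mul, Complex.conj_conj]
      ring
    simp_rw [e1, e2]
    refine integral_integral_swap ?_
    have e3 : Integrable (fun z : X × Y => F z.2) (μ.prod ν) := hFi.comp_snd μ
    have e4 := e3.bdd_mul (c := B * D) (f := fun z : X × Y => K z.1 z.2 * conj (G z.1))
      (hKs.mul (Complex.continuous_conj.comp_stronglyMeasurable
        (hGm.comp_measurable measurable_fst))).aestronglyMeasurable
      (Filter.Eventually.of_forall fun z => by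
        rw [norm_mul, RCLike.norm_conj]
        exact mul_le_mul (hB _ _) (hGD _) (norm_nonneg _) ((norm_nonneg _).trans (hB z.1 z.2)))
    refine e4.congr (Filter.Eventually.of_forall fun z => ?_)
    simp only [Function.uncurry]
    ring
  have h2 : a ≤ (∫⁻ y, ‖F y‖ₑ ^ 2 ∂ν) ^ (1 / 2 : ℝ) * (∫⁻ y, ‖H y‖ₑ ^ 2 ∂ν) ^ (1 / 2 : ℝ) := by
    rw [h1]
    refine (enorm_integral_le_lintegral_enorm _).trans ?_
    have := ENNReal.lintegral_mul_le_Lp_mul_Lq ν (p := 2) (q := 2) (by constructor <;> norm_num)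
      hFm.enorm.aemeasurable hHm.enorm.aemeasurable
    simpa [enorm_mul] using this
  -- the form
  have h3 : ∫⁻ y, ‖H y‖ₑ ^ 2 ∂ν ≤ A * a := by
    rw [← enorm_integral_mul_conj hH2]
    have e1 : ∀ y, H y * conj (H y) = ∫ z, (conj (K z.1 y) * G z.1) *
        conj (conj (K z.2 y) * G z.2) ∂(μ.prod μ) := fun y => by
      rw [integral_prod_mul (fun x => conj (K x y) * G x)
        (fun x => conj (conj (K x y) * G x)), integral_conj]
    simp_rw [e1]
    have hint : Integrable (Function.uncurry fun (y : Y) (z : X × X) =>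
        (conj (K z.1 y) * G z.1) * conj (conj (K z.2 y) * G z.2)) (ν.prod (μ.prod μ)) := by
      refine Integrable.of_bound (C := (B * D) * (B * D)) ?_
        (Filter.Eventually.of_forall fun z => ?_)
      · have m1 : StronglyMeasurable fun z : Y × X × X => K z.2.1 z.1 :=
          hKs.comp_measurable (g := fun z : Y × X × X => (z.2.1, z.1)) (by fun_prop)
        have m2 : StronglyMeasurable fun z : Y × X × X => K z.2.2 z.1 :=
          hKs.comp_measurable (g := fun z : Y × X × X => (z.2.2, z.1)) (by fun_prop)
        have m3 : StronglyMeasurable fun z : Y × X × X => G z.2.1 :=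
          hGm.comp_measurable (g := fun z : Y × X × X => z.2.1) (by fun_prop)
        have m4 : StronglyMeasurable fun z : Y × X × X => G z.2.2 :=
          hGm.comp_measurable (g := fun z : Y × X × X => z.2.2) (by fun_prop)
        exact (((Complex.continuous_conj.comp_stronglyMeasurable m1).mul m3).mul
          (Complex.continuous_conj.comp_stronglyMeasurable
            ((Complex.continuous_conj.comp_stronglyMeasurable m2).mul m4))).aestronglyMeasurable
      · simp only [Function.uncurry]
        rw [norm_mul, norm_mul, RCLike.norm_conj, RCLike.norm_conj, norm_mul, RCLike.norm_conj]
        have b1 := hB z.2.1 z.1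
        have b2 := hB z.2.2 z.1
        have b3 := hGD z.2.1
        have b4 := hGD z.2.2
        have b5 := (norm_nonneg _).trans b1
        have b6 := (norm_nonneg _).trans b3
        gcongr
    rw [integral_integral_swap hint]
    refine (enorm_integral_le_lintegral_enorm _).trans ?_
    have hmeas : StronglyMeasurable fun z : X × X => ∫ y, K z.1 y * conj (K z.2 y) ∂ν := by
      have m1 : StronglyMeasurable fun z : (X × X) × Y => K z.1.1 z.2 :=
        hKs.comp_measurable (g := fun z : (X × X) × Y => (z.1.1, z.2)) (by fun_prop)
      have m2 : StronglyMeasurable fun z : (X × X) × Y => K z.1.2 z.2 :=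
        hKs.comp_measurable (g := fun z : (X × X) × Y => (z.1.2, z.2)) (by fun_prop)
      exact (m1.mul (Complex.continuous_conj.comp_stronglyMeasurable m2)).integral_prod_right
    have e2 : ∀ z : X × X, ‖∫ y, (conj (K z.1 y) * G z.1) * conj (conj (K z.2 y) * G z.2) ∂ν‖ₑ
        = ENNReal.ofReal ‖G z.1‖ * ENNReal.ofReal ‖G z.2‖ *
          ‖∫ y, K z.1 y * conj (K z.2 y) ∂ν‖ₑ := fun z => by
      have : ∀ y, (conj (K z.1 y) * G z.1) * conj (conj (K z.2 y) * G z.2)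
          = (G z.1 * conj (G z.2)) * conj (K z.1 y * conj (K z.2 y)) := fun y => by
        simp only [map_mul, Complex.conj_conj]
        ring
      simp_rw [this]
      rw [integral_const_mul, integral_conj, enorm_mul, enorm_mul, RCLike.enorm_conj,
        RCLike.enorm_conj, ofReal_norm, ofReal_norm]
    simp_rw [e2]
    rw [lintegral_prod]
    · have := hform (fun x => ‖G x‖) hGm.norm.measurable (fun x => norm_nonneg _) ⟨D, hGD⟩
      simpa only [ofReal_norm] using this
    · have m3 := hGm.norm.measurable
      exact ((((m3.comp measurable_fst).ennreal_ofReal).mul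
        ((m3.comp measurable_snd).ennreal_ofReal)).mul hmeas.enorm).aemeasurable
  set f := ∫⁻ y, ‖F y‖ₑ ^ 2 ∂ν
  have h4 : a ≤ f ^ (1 / 2 : ℝ) * (A * a) ^ (1 / 2 : ℝ) :=
    h2.trans (by gcongr)
  rw [← ENNReal.mul_rpow_of_nonneg _ _ (by norm_num)] at h4
  -- With G = TF and H = T*G, duality gives ‖G‖² ≤ ‖F‖ ‖H‖, while ‖H‖² is the TT* form at G, at most
  -- A‖G‖². Absolute values are taken inside the form, so nonnegative test functions suffice.
  have h5 : a * a ≤ A * f * a := by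
    have := pow_le_pow_left' h4 2
    rw [← ENNReal.rpow_natCast, ← ENNReal.rpow_natCast, ← ENNReal.rpow_mul] at this
    norm_num at this
    calc a * a = a ^ 2 := (sq a).symm
      _ ≤ f * (A * a) := this
      _ = A * f * a := by ring
  rcases eq_or_ne a 0 with h0 | h0
  · rw [h0]; exact zero_le
  · exact (ENNReal.mul_le_mul_iff_left h0 hafin).1 h5

end QuadCarleson

/-! ### Tiles, mass, and the measure of the points whose lines are close to a given line. -/

namespace QuadCarleson

open scoped ENNReal

/-- Nesting of dyadic intervals: the index at the coarser scale is the integer quotient by 2^(k-j)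
of the index at the finer one. -/
lemma floor_mul_two_pow_eq {x y : ℝ} {j k : ℕ} (hjk : j ≤ k)
    (h : ⌊x * 2 ^ k⌋ = ⌊y * 2 ^ k⌋) : ⌊x * 2 ^ j⌋ = ⌊y * 2 ^ j⌋ := by
  have key : ∀ z : ℝ, ⌊z * 2 ^ j⌋ = ⌊z * 2 ^ k⌋ / ((2 ^ (k - j) : ℕ) : ℤ) := fun z => by
    rw [← Int.floor_div_natCast]
    congr 1
    push_cast
    rw [eq_div_iff (by positivity), mul_assoc, ← pow_add, Nat.add_sub_cancel' hjk]
  rw [key, key, h]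

lemma Intvl.mem_dyadic_neg {j : ℕ} {i : ℤ} {x : ℝ} :
    x ∈ (Intvl.dyadic (-(j : ℤ)) i).toSet ↔ ⌊x * 2 ^ j⌋ = i := by
  have h2 : (0 : ℝ) < 2 ^ j := by positivity
  simp only [Intvl.toSet, Intvl.hi, Intvl.dyadic, mem_Ico, Int.floor_eq_iff, zpow_neg,
    zpow_natCast, ← div_eq_mul_inv]
  rw [div_le_iff₀ h2, ← one_div, ← add_div, lt_div_iff₀ h2]

lemma Intvl.mem_dyadic {j : ℕ} {i : ℤ} {x : ℝ} :
    x ∈ (Intvl.dyadic (j : ℤ) i).toSet ↔ ⌊x / 2 ^ j⌋ = i := by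
  have h2 : (0 : ℝ) < 2 ^ j := by positivity
  simp only [Intvl.toSet, Intvl.hi, Intvl.dyadic, mem_Ico, Int.floor_eq_iff, zpow_natCast]
  rw [le_div_iff₀ h2, div_lt_iff₀ h2, add_mul, one_mul]

lemma Intvl.subset_dilate_two {J : Intvl} : J.toSet ⊆ (J.dilate 2).toSet := by
  intro x hx
  simp only [Intvl.toSet, Intvl.hi, Intvl.dilate, Intvl.center, mem_Ico] at hx ⊢
  constructor <;> linarith [hx.1, hx.2]

namespace Tile

lemma mem_I {P : Tile} {x : ℝ} : x ∈ P.I ↔ ⌊x * 2 ^ P.k⌋ = P.i := Intvl.mem_dyadic_neg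

lemma volume_I (P : Tile) : volume P.I = ENNReal.ofReal (1 / 2 ^ P.k) := by
  simp [I, box, Intvl.toSet, Intvl.hi, Intvl.dyadic]

lemma I_subset (P : Tile) : P.I ⊆ Ico 0 1 := by
  intro x hx
  rw [mem_I, Int.floor_eq_iff] at hx
  have h2 : (0 : ℝ) < 2 ^ P.k := by positivity
  have h0 : (0 : ℝ) ≤ P.i := by exact_mod_cast P.i_nonneg
  have h1 : (P.i : ℝ) + 1 ≤ 2 ^ P.k := by exact_mod_cast P.i_lt
  constructor
  · by_contra! h
    nlinarith
  · by_contra! h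
    nlinarith

lemma hasLine_dilate_two {P : Tile} {l : Line} (h : P.box.HasLine l) :
    (P.box.dilate 2).HasLine l :=
  ⟨Intvl.subset_dilate_two h.1, Intvl.subset_dilate_two h.2⟩

lemma abs_sub_le_of_mem_I {P : Tile} {s t : ℝ} (hs : s ∈ P.I) (ht : t ∈ P.I) :
    |s - t| ≤ 1 / 2 ^ P.k := by
  have h2 : (0 : ℝ) < 2 ^ P.k := by positivity
  rw [mem_I, Int.floor_eq_iff] at hs ht
  rw [le_div_iff₀ h2, ← abs_of_pos h2, ← abs_mul, sub_mul, abs_le]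
  constructor <;> linarith [hs.1, hs.2, ht.1, ht.2]

end Tile

namespace Box

lemma lineDist_nonneg (A : Set ℝ) (l₁ l₂ : Line) : 0 ≤ lineDist A l₁ l₂ :=
  Real.sSup_nonneg (by rintro _ ⟨x, _, rfl⟩; exact abs_nonneg _)

lemma deltaAux_nonneg {P Q : Box} (hQ : 0 ≤ Q.right.len) : 0 ≤ deltaAux P Q :=
  div_nonneg (Real.sInf_nonneg (by rintro _ ⟨l₁, l₂, _, _, rfl⟩; exact lineDist_nonneg ..)) hQ

lemma deltaAux_le {P Q : Box} {l₁ l₂ : Line} {K : ℝ} (hK : 0 ≤ K) (hQ : 0 < Q.right.len)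
    (h₁ : P.HasLine l₁) (h₂ : Q.HasLine l₂)
    (h : ∀ t ∈ Q.time.toSet, |l₁.eval t - l₂.eval t| ≤ K * Q.right.len) : deltaAux P Q ≤ K := by
  rw [deltaAux, div_le_iff₀ hQ]
  have h₃ : sInf {d : ℝ | ∃ l₁ l₂ : Line, P.HasLine l₁ ∧ Q.HasLine l₂ ∧
      d = lineDist Q.time.toSet l₁ l₂} ≤ lineDist Q.time.toSet l₁ l₂ :=
    csInf_le ⟨0, by rintro _ ⟨l₁, l₂, _, _, rfl⟩; exact lineDist_nonneg ..⟩ ⟨l₁, l₂, h₁, h₂, rfl⟩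
  refine h₃.trans (Real.sSup_le ?_ (by positivity))
  rintro _ ⟨t, ht, rfl⟩
  exact h t ht

lemma delta_dilate_two_nonneg (P Q : Tile) : 0 ≤ delta (P.box.dilate 2) (Q.box.dilate 2) := by
  unfold delta
  split_ifs <;> exact deltaAux_nonneg
    (by simp only [dilate, Tile.box, Intvl.dilate, Intvl.dyadic]; positivity)

end Box

lemma bracket_nonneg (x : ℝ) : 0 ≤ bracket x := by unfold bracket; positivity

lemma bracket_le_one (x : ℝ) : bracket x ≤ 1 := by
  unfold bracket
  rw [div_le_one (by positivity)]
  linarith [abs_nonneg x]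

section Mass

variable {ℙ : Set Tile} {N : ℕ} {c b : ℝ → ℝ}

lemma volumeReal_tileE_div_le_one (P : Tile) :
    volume.real (tileE c b P) / volume.real P.I ≤ 1 := by
  refine div_le_one_of_le₀ (measureReal_mono (fun x hx => hx.1) ?_) measureReal_nonneg
  rw [Tile.volume_I]
  exact ENNReal.ofReal_ne_top

lemma mass_term_le_one (P Q : Tile) : volume.real (tileE c b Q) / volume.real Q.I *
    bracket (Box.delta (P.box.dilate 2) (Q.box.dilate 2)) ^ N ≤ 1 :=
  mul_le_one₀ (volumeReal_tileE_div_le_one Q) (pow_nonneg (bracket_nonneg _) _)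
    (pow_le_one₀ (bracket_nonneg _) (bracket_le_one _))

lemma mass_le_one (P : Tile) : mass ℙ N c b P ≤ 1 := by
  refine Real.sSup_le ?_ zero_le_one
  rintro _ ⟨Q, _, _, rfl⟩
  exact mass_term_le_one P Q

lemma le_mass {P Q : Tile} (hQ : Q ∈ ℙ) (hI : P.I ⊆ Q.I) :
    volume.real (tileE c b Q) / volume.real Q.I *
      bracket (Box.delta (P.box.dilate 2) (Q.box.dilate 2)) ^ N ≤ mass ℙ N c b P := by
  refine le_csSup ⟨1, ?_⟩ ⟨Q, hQ, hI, rfl⟩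
  rintro _ ⟨Q, _, _, rfl⟩
  exact mass_term_le_one P Q

/-- Q competes in the supremum defining the mass of P, with weight at least (1 + K)^(-N). Small mass
of one tile thus bounds E(Q) for all nearby tiles Q over larger time intervals. -/
lemma volume_tileE_le {P Q : Tile} {K δ : ℝ} (hQ : Q ∈ ℙ) (hI : P.I ⊆ Q.I)
    (hP : mass ℙ N c b P ≤ δ) (hΔ : Box.delta (P.box.dilate 2) (Q.box.dilate 2) ≤ K) :
    volume (tileE c b Q) ≤ ENNReal.ofReal ((1 + K) ^ N * δ / 2 ^ Q.k) := by
  set Δ := Box.delta (P.box.dilate 2) (Q.box.dilate 2)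
  have hΔ0 : 0 ≤ Δ := Box.delta_dilate_two_nonneg P Q
  have hK : 0 ≤ K := hΔ0.trans hΔ
  have hfin : volume (tileE c b Q) ≠ ∞ :=
    measure_ne_top_of_subset (fun x hx => hx.1) (by rw [Tile.volume_I]; exact ENNReal.ofReal_ne_top)
  have h1 := (le_mass (N := N) (c := c) (b := b) hQ hI).trans hP
  have hvI : volume.real Q.I = 1 / 2 ^ Q.k := by
    rw [measureReal_def, Tile.volume_I, ENNReal.toReal_ofReal (by positivity)]
  have h2 : 1 / (1 + K) ≤ bracket Δ := by
    rw [bracket, abs_of_nonneg hΔ0]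
    gcongr
  have h3 : volume.real (tileE c b Q) / volume.real Q.I * (1 / (1 + K)) ^ N ≤ δ := by
    refine le_trans ?_ h1
    gcongr
  rw [hvI, div_div_eq_mul_div, div_one, one_div, inv_pow, ← div_eq_mul_inv,
    div_le_iff₀ (by positivity)] at h3
  rw [← ENNReal.ofReal_toReal hfin]
  refine ENNReal.ofReal_le_ofReal ?_
  rw [le_div_iff₀ (by positivity)]
  exact h3.trans_eq (mul_comm _ _)

end Mass

/-- At the scale `2^{-k}` around `x`, the line `l_x` is within `K 2^k` of the line `l`. -/
def CloseAt (K : ℝ) (l : Line) (c b : ℝ → ℝ) (k : ℕ) (x : ℝ) : Prop :=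
  |Line.eval ⟨c x, b x⟩ x - l.eval x| + 10 * |b x - l.b| / 2 ^ k ≤ K * 2 ^ k

section Close

variable {K : ℝ} {l : Line} {c b : ℝ → ℝ}

/-- At finer scales the slope counts less and the tile height is larger, so closeness passes from
coarse to fine. This lets points of several scales be tested at one common finer scale. -/
lemma CloseAt.mono {j k : ℕ} {x : ℝ} (hK : 0 ≤ K) (hjk : j ≤ k) (h : CloseAt K l c b j x) :
    CloseAt K l c b k x := by
  have h1 : (2 : ℝ) ^ j ≤ 2 ^ k := pow_le_pow_right₀ (by norm_num) hjk
  unfold CloseAt at h ⊢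
  calc _ ≤ |Line.eval ⟨c x, b x⟩ x - l.eval x| + 10 * |b x - l.b| / 2 ^ j := by gcongr
    _ ≤ _ := h
    _ ≤ _ := by gcongr

lemma CloseAt.abs_sub_le {k : ℕ} {x t : ℝ} (h : CloseAt K l c b k x) (ht : |t - x| ≤ 1 / 2 ^ k) :
    |Line.eval ⟨c x, b x⟩ t - l.eval t| ≤ K * 2 ^ k := by
  have h1 : Line.eval ⟨c x, b x⟩ t - l.eval t
      = (Line.eval ⟨c x, b x⟩ x - l.eval x) + 2 * (b x - l.b) * (t - x) := by
    simp only [Line.eval]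
    ring
  rw [h1]
  refine (abs_add_le _ _).trans (le_trans ?_ h)
  rw [abs_mul, abs_mul, abs_two]
  gcongr
  calc 2 * |b x - l.b| * |t - x| ≤ 2 * |b x - l.b| * (1 / 2 ^ k) := by gcongr
    _ = 2 * |b x - l.b| / 2 ^ k := by ring
    _ ≤ _ := by gcongr; norm_num

lemma card_Icc_floor_le {K : ℝ} (hK : 0 ≤ K) (a : ℝ) :
    ((Finset.Icc ⌊a - K⌋ ⌊a + K⌋).card : ℝ) ≤ 2 * (1 + K) := by
  rw [Int.card_Icc]
  have h1 : ⌊a - K⌋ ≤ ⌊a + K⌋ := Int.floor_le_floor (by linarith)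
  have h2 : (((⌊a + K⌋ + 1 - ⌊a - K⌋).toNat : ℤ) : ℝ) = ⌊a + K⌋ + 1 - ⌊a - K⌋ := by
    rw [Int.toNat_of_nonneg (by lia)]
    push_cast
    ring
  rw [← Int.cast_natCast, h2]
  linarith [Int.floor_le (a + K), Int.lt_floor_add_one (a - K)]

variable {N M r : ℕ} {δ : ℝ}

lemma floor_mem_Icc {a a' K s : ℝ} (hs : 0 < s) (h : |a - a'| ≤ K * s) :
    ⌊a / s⌋ ∈ Finset.Icc ⌊a' / s - K⌋ ⌊a' / s + K⌋ := by
  have h1 := abs_le.1 h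
  rw [Finset.mem_Icc]
  constructor <;> refine Int.floor_le_floor ?_
  · rw [sub_le_iff_le_add, div_le_iff₀ hs, add_mul, div_mul_cancel₀ _ hs.ne']
    linarith
  · rw [div_le_iff₀ hs, add_mul, div_mul_cancel₀ _ hs.ne']
    linarith

/-- The points of a dyadic interval whose lines are close to `l` at the scale of that interval
have small measure, provided that the interval contains the time interval of a tile of small mass
with a line close to `l`. -/
lemma volume_closeAt_le (hK : 0 ≤ K) (hδ : 0 ≤ δ) {P : Tile}
    (hP : mass (sparseTiles M r) N c b P ≤ δ) {x₀ : ℝ} (hx₀ : x₀ ∈ tileE c b P)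
    (hclose : CloseAt K l c b P.k x₀) {j : ℕ} (hj : j ≡ r [MOD M]) (hjk : j ≤ P.k) :
    volume {x | ⌊x * 2 ^ j⌋ = ⌊x₀ * 2 ^ j⌋ ∧ CloseAt K l c b j x}
      ≤ ENNReal.ofReal (4 * (1 + K) ^ (N + 2) * δ / 2 ^ j) := by
  set i := ⌊x₀ * 2 ^ j⌋ with hi
  have h2 : (0 : ℝ) < 2 ^ j := by positivity
  have hx01 := P.I_subset hx₀.1
  have hi0 : 0 ≤ i := Int.floor_nonneg.2 (mul_nonneg hx01.1 h2.le)
  have hi1 : i < 2 ^ j := by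
    rw [hi, Int.floor_lt]
    push_cast
    exact mul_lt_of_lt_one_left h2 hx01.2
  set lo : ℝ := (Intvl.dyadic (-(j : ℤ)) i).lo with hlo
  set hi' : ℝ := (Intvl.dyadic (-(j : ℤ)) i).hi with hhi
  have hlo' : lo = i / 2 ^ j := by
    simp [hlo, Intvl.dyadic, div_eq_mul_inv]
  have hhi' : hi' = (i + 1) / 2 ^ j := by
    simp [hhi, Intvl.hi, Intvl.dyadic, div_eq_mul_inv]
    ring
  have hdist : ∀ x : ℝ, ⌊x * 2 ^ j⌋ = i → |lo - x| ≤ 1 / 2 ^ j ∧ |hi' - x| ≤ 1 / 2 ^ j := by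
    intro x hx
    rw [Int.floor_eq_iff] at hx
    have e : ∀ a : ℝ, |a - x * 2 ^ j| ≤ 1 → |a / 2 ^ j - x| ≤ 1 / 2 ^ j := fun a ha => by
      rw [show a / 2 ^ j - x = (a - x * 2 ^ j) / 2 ^ j by field_simp, abs_div, abs_of_pos h2]
      gcongr
    rw [hlo', hhi']
    constructor <;> refine e _ (abs_le.2 ?_) <;> constructor <;> linarith [hx.1, hx.2]
  -- At each endpoint a close line lies within K tile heights of l, so it meets one of at most 2(1 +
  -- K) dyadic edges. The pairs of edges account for the two extra powers of 1 + K.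
  set U := Finset.Icc ⌊l.eval lo / 2 ^ j - K⌋ ⌊l.eval lo / 2 ^ j + K⌋
  set V := Finset.Icc ⌊l.eval hi' / 2 ^ j - K⌋ ⌊l.eval hi' / 2 ^ j + K⌋
  set S : ℤ × ℤ → Set ℝ := fun p => {x | (⌊x * 2 ^ j⌋ = i ∧ CloseAt K l c b j x) ∧
    ⌊Line.eval ⟨c x, b x⟩ lo / 2 ^ j⌋ = p.1 ∧ ⌊Line.eval ⟨c x, b x⟩ hi' / 2 ^ j⌋ = p.2}
  have hcov : {x | ⌊x * 2 ^ j⌋ = i ∧ CloseAt K l c b j x} ⊆ ⋃ p ∈ U ×ˢ V, S p := by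
    intro x hx
    have hd := hdist x hx.1
    refine mem_biUnion (x := (⌊Line.eval ⟨c x, b x⟩ lo / 2 ^ j⌋,
      ⌊Line.eval ⟨c x, b x⟩ hi' / 2 ^ j⌋)) (Finset.mem_coe.2 (Finset.mem_product.2
        ⟨floor_mem_Icc h2 (hx.2.abs_sub_le hd.1), floor_mem_Icc h2 (hx.2.abs_sub_le hd.2)⟩))
      ⟨hx, rfl, rfl⟩
  have hS : ∀ p, volume (S p) ≤ ENNReal.ofReal ((1 + K) ^ N * δ / 2 ^ j) := by
    intro p
    rcases (S p).eq_empty_or_nonempty with he | ⟨x₁, hx₁⟩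
    · rw [he]; simp
    let Q : Tile := ⟨j, i, p.1, p.2, hi0, hi1⟩
    have hsub : S p ⊆ tileE c b Q := fun x hx =>
      ⟨Tile.mem_I.2 hx.1.1, Intvl.mem_dyadic.2 hx.2.1, Intvl.mem_dyadic.2 hx.2.2⟩
    have hPQ : P.I ⊆ Q.I := by
      intro x hx
      rw [Tile.mem_I] at hx ⊢
      exact floor_mul_two_pow_eq hjk (hx.trans (Tile.mem_I.1 hx₀.1).symm)
    -- Both lines are within K 2^k, k = `P.k`, of l on `P.I`, hence within 2K 2^k of each other.
    -- Dividing by the doubled edge 2 · 2^k leaves K. The first branch of `delta` occurs only when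
    -- the scales agree.
    have hΔ : Box.delta (P.box.dilate 2) (Q.box.dilate 2) ≤ K := by
      have hjk' : (2 : ℝ) ^ j ≤ 2 ^ P.k := pow_le_pow_right₀ (by norm_num) hjk
      have hl0 := Tile.hasLine_dilate_two hx₀.2
      have hl1 := Tile.hasLine_dilate_two (hsub hx₁).2
      have hb0 : ∀ t ∈ P.I, |Line.eval ⟨c x₀, b x₀⟩ t - l.eval t| ≤ K * 2 ^ P.k := fun t ht =>
        hclose.abs_sub_le (Tile.abs_sub_le_of_mem_I ht hx₀.1)
      have hb1 : ∀ t ∈ Q.I, |Line.eval ⟨c x₁, b x₁⟩ t - l.eval t| ≤ K * 2 ^ j := fun t ht =>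
        hx₁.1.2.abs_sub_le (Tile.abs_sub_le_of_mem_I (P := Q) ht (hsub hx₁).1)
      unfold Box.delta
      split_ifs with hlen
      · have hk : P.k ≤ j := by
          have h3 : (2 : ℝ) ^ (-(j : ℤ)) ≤ 2 ^ (-(P.k : ℤ)) := hlen
          rw [zpow_le_zpow_iff_right₀ (by norm_num)] at h3
          lia
        refine Box.deltaAux_le hK ?_ hl0 hl1 fun t ht => ?_
        · simp only [Box.dilate, Tile.box, Intvl.dilate, Intvl.dyadic]; positivity
        have ht1 : t ∈ Q.I := ht
        have ht0 : t ∈ P.I := by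
          rw [Tile.mem_I] at ht1 ⊢
          rw [← Tile.mem_I.1 hx₀.1]
          exact floor_mul_two_pow_eq hk ht1
        have e : P.k = j := le_antisymm hk hjk
        have h3 := hb0 t ht0
        have h4 := hb1 t ht1
        rw [e] at h3
        have h5 : (Box.dilate 2 Q.box).right.len = 2 * 2 ^ j := by
          simp [Box.dilate, Tile.box, Intvl.dilate, Intvl.dyadic, Q]
        rw [h5, show Line.eval ⟨c x₀, b x₀⟩ t - Line.eval ⟨c x₁, b x₁⟩ t
          = (Line.eval ⟨c x₀, b x₀⟩ t - l.eval t) - (Line.eval ⟨c x₁, b x₁⟩ t - l.eval t) by ring]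
        refine (abs_sub _ _).trans ?_
        linarith
      · refine Box.deltaAux_le hK ?_ hl1 hl0 fun t ht => ?_
        · simp only [Box.dilate, Tile.box, Intvl.dilate, Intvl.dyadic]; positivity
        have ht0 : t ∈ P.I := ht
        have h3 := hb0 t ht0
        have h4 := hb1 t (hPQ ht0)
        have h5 : (Box.dilate 2 P.box).right.len = 2 * 2 ^ P.k := by
          simp [Box.dilate, Tile.box, Intvl.dilate, Intvl.dyadic]
        rw [h5, show Line.eval ⟨c x₁, b x₁⟩ t - Line.eval ⟨c x₀, b x₀⟩ t
          = (Line.eval ⟨c x₁, b x₁⟩ t - l.eval t) - (Line.eval ⟨c x₀, b x₀⟩ t - l.eval t) by ring]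
        refine (abs_sub _ _).trans ?_
        have : K * 2 ^ j ≤ K * 2 ^ P.k := by gcongr
        linarith
    exact (measure_mono hsub).trans (volume_tileE_le (Q := Q) hj hPQ hP hΔ)
  calc _ ≤ volume (⋃ p ∈ U ×ˢ V, S p) := measure_mono hcov
    _ ≤ ∑ p ∈ U ×ˢ V, volume (S p) := measure_biUnion_finset_le _ _
    _ ≤ ∑ _p ∈ U ×ˢ V, ENNReal.ofReal ((1 + K) ^ N * δ / 2 ^ j) :=
        Finset.sum_le_sum fun p _ => hS p
    _ = ENNReal.ofReal ((U.card * V.card) * ((1 + K) ^ N * δ / 2 ^ j)) := by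
        rw [Finset.sum_const, Finset.card_product, nsmul_eq_mul,
          ENNReal.ofReal_mul (by positivity), ← Nat.cast_mul, ENNReal.ofReal_natCast]
    _ ≤ ENNReal.ofReal ((2 * (1 + K) * (2 * (1 + K))) * ((1 + K) ^ N * δ / 2 ^ j)) := by
        refine ENNReal.ofReal_le_ofReal ?_
        gcongr
        · exact card_Icc_floor_le hK _
        · exact card_Icc_floor_le hK _
    _ = _ := by
        congr 1
        ring

/-! ### Close points of different scales: a stopping argument. -/

variable {G : Set ℝ} {k : ℝ → ℕ} {n : ℕ}

/-- `G` consists of points `x` of `E(P)` for tiles `P` of scale `k x ≤ n` and mass at most `δ`,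
with `l_x` close to `l`. -/
def IsCloseSet (M r N : ℕ) (c b : ℝ → ℝ) (K δ : ℝ) (l : Line) (k : ℝ → ℕ) (n : ℕ) (G : Set ℝ) :
    Prop :=
  ∀ x ∈ G, k x ≤ n ∧ CloseAt K l c b (k x) x ∧ ∃ P : Tile, P.k = k x ∧ P ∈ sparseTiles M r ∧
    mass (sparseTiles M r) N c b P ≤ δ ∧ x ∈ tileE c b P

/-- Induction from fine to coarse intervals, m counting the scales left up to n + 1. Halve the
interval. A half containing a point of G of scale at least j + 1 is covered by induction; in any
other half all scales are at most j, so the points are close at one common scale and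
`volume_closeAt_le` applies. The bound is proportional to length, so the two halves add up with no
loss and the number of scales does not enter. -/
lemma IsCloseSet.volume_inter_le (hM : 1 ≤ M) (hK : 0 ≤ K) (hδ : 0 ≤ δ)
    (hG : IsCloseSet M r N c b K δ l k n G) (m : ℕ) :
    ∀ j : ℕ, j + m = n + 1 → ∀ x₀ ∈ G, j ≤ k x₀ →
      volume (G ∩ {x | ⌊x * 2 ^ j⌋ = ⌊x₀ * 2 ^ j⌋})
        ≤ ENNReal.ofReal (2 ^ M * (4 * (1 + K) ^ (N + 2) * δ) / 2 ^ j) := by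
  induction m with
  | zero =>
    intro j hj x₀ hx₀ hjk
    have := (hG x₀ hx₀).1
    lia
  | succ m ih =>
    intro j hj x₀ hx₀ hjk
    set θ := 4 * (1 + K) ^ (N + 2) * δ with hθ
    have hθ0 : 0 ≤ θ := by positivity
    set J := {x : ℝ | ⌊x * 2 ^ j⌋ = ⌊x₀ * 2 ^ j⌋}
    have child : ∀ i : ℤ, volume (G ∩ J ∩ {x | ⌊x * 2 ^ (j + 1)⌋ = i})
        ≤ ENNReal.ofReal (2 ^ M * θ / 2 ^ (j + 1)) := by
      intro i
      by_cases hgood : ∃ x₁ ∈ G, ⌊x₁ * 2 ^ (j + 1)⌋ = i ∧ j + 1 ≤ k x₁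
      · obtain ⟨x₁, hx₁, hi, hjk₁⟩ := hgood
        refine (measure_mono ?_).trans (ih (j + 1) (by lia) x₁ hx₁ hjk₁)
        exact fun x hx => ⟨hx.1.1, hx.2.trans hi.symm⟩
      push Not at hgood
      rcases (G ∩ J ∩ {x : ℝ | ⌊x * 2 ^ (j + 1)⌋ = i}).eq_empty_or_nonempty with he | ⟨x₁, hx₁⟩
      · rw [he]; simp
      have hsp : ∀ x ∈ G, k x ≡ r [MOD M] := fun x hx => by
        obtain ⟨_, _, P, hPk, hPs, _⟩ := hG x hx
        exact hPk ▸ hPs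
      have hk₁ : k x₁ ≤ j := by
        have := hgood x₁ hx₁.1.1 hx₁.2
        lia
      -- The last scale up to j in the residue class of r, the only ones carrying tiles of the
      -- collection. All scales in this half lie in that class, hence are at most j'. As j + 1 - j'
      -- ≤ M, rounding costs at most 2^M.
      set j' := j - (j - k x₁) % M with hj'
      have hmod : (j - k x₁) % M < M := Nat.mod_lt _ hM
      have hmodle : (j - k x₁) % M ≤ j - k x₁ := Nat.mod_le _ _
      have hj'1 : j' ≡ k x₁ [MOD M] := by
        have e : j' = k x₁ + M * ((j - k x₁) / M) := by
          have := Nat.mod_add_div (j - k x₁) M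
          lia
        rw [e]
        simp [Nat.ModEq]
      have hj'r : j' ≡ r [MOD M] := hj'1.trans (hsp x₁ hx₁.1.1)
      have hj'j : j' ≤ j := by lia
      have hjj' : j + 1 ≤ M + j' := by lia
      have hkle : ∀ x ∈ G ∩ J ∩ {x | ⌊x * 2 ^ (j + 1)⌋ = i}, k x ≤ j' := by
        intro x hx
        by_contra! hlt
        have h1 : k x ≤ j := by
          have := hgood x hx.1.1 hx.2
          lia
        have h2 : M ∣ k x - j' :=
          (Nat.modEq_iff_dvd' hlt.le).1 (hj'r.trans (hsp x hx.1.1).symm)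
        have := Nat.le_of_dvd (by lia) h2
        lia
      -- The tile of x₀ is used, not that of x₁: a mass controls only intervals containing the time
      -- interval of its tile, and k x₀ ≥ j ≥ j'.
      obtain ⟨_, hcl₀, P, hPk, _, hPm, hPx⟩ := hG x₀ hx₀
      have key := volume_closeAt_le hK hδ hPm hPx (hPk ▸ hcl₀) hj'r (by lia)
      refine (measure_mono fun x hx => ?_).trans (key.trans (ENNReal.ofReal_le_ofReal ?_))
      · exact ⟨floor_mul_two_pow_eq hj'j hx.1.2, (hG x hx.1.1).2.1.mono hK (hkle x hx)⟩
      · rw [div_le_div_iff₀ (by positivity) (by positivity)]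
        calc θ * 2 ^ (j + 1) ≤ θ * 2 ^ (M + j') := by gcongr; norm_num
          _ = _ := by rw [pow_add]; ring
    set i₀ := ⌊x₀ * 2 ^ j⌋
    have hsub : G ∩ J ⊆ (G ∩ J ∩ {x | ⌊x * 2 ^ (j + 1)⌋ = 2 * i₀})
        ∪ (G ∩ J ∩ {x | ⌊x * 2 ^ (j + 1)⌋ = 2 * i₀ + 1}) := by
      intro x hx
      have h1 : ⌊x * 2 ^ j⌋ = i₀ := hx.2
      rw [Int.floor_eq_iff] at h1
      rcases lt_or_ge (x * 2 ^ (j + 1)) (2 * i₀ + 1) with h | h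
      · left
        refine ⟨hx, Int.floor_eq_iff.2 ?_⟩
        push_cast
        exact ⟨by rw [pow_succ]; linarith [h1.1], h⟩
      · right
        refine ⟨hx, Int.floor_eq_iff.2 ?_⟩
        push_cast
        exact ⟨h, by rw [pow_succ]; linarith [h1.2]⟩
    calc _ ≤ _ := measure_mono hsub
      _ ≤ _ := measure_union_le _ _
      _ ≤ _ := add_le_add (child _) (child _)
      _ = _ := by
        rw [← ENNReal.ofReal_add (by positivity) (by positivity)]
        congr 1
        rw [pow_succ]
        field_simp
        ring

/-- A window of radius 10 · 2^(-j) meets at most 21 dyadic intervals of length 2^(-j), and 21 · 4 =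
84. -/
lemma IsCloseSet.volume_le (hM : 1 ≤ M) (hK : 0 ≤ K) (hδ : 0 ≤ δ)
    (hG : IsCloseSet M r N c b K δ l k n G) {j : ℕ} {x' : ℝ} (hj : ∀ x ∈ G, j ≤ k x)
    (hx' : ∀ x ∈ G, |x - x'| ≤ 10 / 2 ^ j) :
    volume G ≤ ENNReal.ofReal (84 * 2 ^ M * (1 + K) ^ (N + 2) * δ / 2 ^ j) := by
  have h2 : (0 : ℝ) < 2 ^ j := by positivity
  set i' := ⌊x' * 2 ^ j⌋
  have hpiece : ∀ i : ℤ, volume (G ∩ {x | ⌊x * 2 ^ j⌋ = i})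
      ≤ ENNReal.ofReal (2 ^ M * (4 * (1 + K) ^ (N + 2) * δ) / 2 ^ j) := by
    intro i
    rcases (G ∩ {x : ℝ | ⌊x * 2 ^ j⌋ = i}).eq_empty_or_nonempty with he | ⟨x₀, hx₀⟩
    · rw [he]; simp
    have h1 : j ≤ n := (hj x₀ hx₀.1).trans (hG x₀ hx₀.1).1
    have := hG.volume_inter_le hM hK hδ (n + 1 - j) j (by lia) x₀ hx₀.1 (hj x₀ hx₀.1)
    rwa [show ⌊x₀ * 2 ^ j⌋ = i from hx₀.2] at this
  have hcov : G ⊆ ⋃ i ∈ Finset.Icc (i' - 10) (i' + 10), G ∩ {x | ⌊x * 2 ^ j⌋ = i} := by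
    intro x hx
    refine mem_biUnion (x := ⌊x * 2 ^ j⌋) (Finset.mem_coe.2 (Finset.mem_Icc.2 ?_)) ⟨hx, rfl⟩
    have h3 := hx' x hx
    rw [le_div_iff₀ h2, ← abs_of_pos h2, ← abs_mul, sub_mul, abs_le] at h3
    have h4 := Int.floor_le (x * 2 ^ j)
    have h5 := Int.lt_floor_add_one (x * 2 ^ j)
    have h6 := Int.floor_le (x' * 2 ^ j)
    have h7 := Int.lt_floor_add_one (x' * 2 ^ j)
    constructor
    · have : (i' : ℝ) < ⌊x * 2 ^ j⌋ + 11 := by linarith [h3.1]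
      have : i' < ⌊x * 2 ^ j⌋ + 11 := by exact_mod_cast this
      lia
    · have : (⌊x * 2 ^ j⌋ : ℝ) < i' + 11 := by linarith [h3.2]
      have : ⌊x * 2 ^ j⌋ < i' + 11 := by exact_mod_cast this
      lia
  calc _ ≤ _ := measure_mono hcov
    _ ≤ _ := measure_biUnion_finset_le _ _
    _ ≤ ∑ _i ∈ Finset.Icc (i' - 10) (i' + 10),
          ENNReal.ofReal (2 ^ M * (4 * (1 + K) ^ (N + 2) * δ) / 2 ^ j) :=
        Finset.sum_le_sum fun i _ => hpiece i
    _ = _ := by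
        rw [Finset.sum_const, Int.card_Icc, show (i' + 10 + 1 - (i' - 10)).toNat = 21 by lia,
          nsmul_eq_mul, Nat.cast_ofNat, ← ENNReal.ofReal_ofNat 21,
          ← ENNReal.ofReal_mul (by norm_num)]
        congr 1
        ring

end Close

end QuadCarleson

/-! ### The kernel and its correlations. -/

namespace QuadCarleson

open scoped ENNReal ComplexConjugate

/-- The phase `l_x(x) y - b(x) y²` of the operator, at `x - y`. -/
noncomputable def phase (c b : ℝ → ℝ) (x y : ℝ) : ℝ :=
  Line.eval ⟨c x, b x⟩ x * (x - y) - b x * (x - y) ^ 2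

/-- The kernel of the linearized operator with the scale `k x` at the point `x`. -/
noncomputable def kernel (ψ c b : ℝ → ℝ) (k : ℝ → ℕ) (x y : ℝ) : ℂ :=
  Complex.exp (Complex.I * (phase c b x y : ℂ)) * (psiScale ψ (k x) (x - y) : ℂ)

section Kernel

variable {ψ c b : ℝ → ℝ} {k : ℝ → ℕ} {S : ℝ}

lemma measurable_kernel (hψ : Measurable ψ) (hc : Measurable c) (hb : Measurable b)
    (hk : Measurable k) : Measurable (Function.uncurry (kernel ψ c b k)) := by
  have h2 : Measurable fun z : ℝ × ℝ => (2 : ℝ) ^ k z.1 :=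
    (measurable_from_top (f := fun m : ℕ => (2 : ℝ) ^ m)).comp (hk.comp measurable_fst)
  have hb' : Measurable fun z : ℝ × ℝ => b z.1 := hb.comp measurable_fst
  have hc' : Measurable fun z : ℝ × ℝ => c z.1 := hc.comp measurable_fst
  unfold kernel phase psiScale Line.eval Function.uncurry
  refine Measurable.mul ?_ ?_
  · exact Complex.measurable_exp.comp (Measurable.const_mul
      (Complex.measurable_ofReal.comp (by fun_prop)) _)
  · exact Complex.measurable_ofReal.comp (h2.mul (hψ.comp (h2.mul (by fun_prop))))

lemma norm_kernel_le (hS : ∀ y, |ψ y| ≤ S) {n : ℕ} (hk : ∀ x, k x ≤ n) (x y : ℝ) :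
    ‖kernel ψ c b k x y‖ ≤ 2 ^ n * S := by
  have hS0 : 0 ≤ S := (abs_nonneg _).trans (hS 0)
  rw [kernel, norm_mul, mul_comm Complex.I, Complex.norm_exp_ofReal_mul_I, one_mul,
    Complex.norm_real, psiScale, Real.norm_eq_abs, abs_mul, abs_of_pos (by positivity)]
  gcongr
  · norm_num
  · exact hk x
  · exact hS _

lemma psiScale_eq_zero (hsupp : ∀ y, 5 ≤ |y| → ψ y = 0) {j : ℕ} {y : ℝ} (hy : 5 / 2 ^ j ≤ |y|) :
    psiScale ψ j y = 0 := by
  have h2 : (0 : ℝ) < 2 ^ j := by positivity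
  rw [psiScale, hsupp, mul_zero]
  rw [abs_mul, abs_of_pos h2, mul_comm]
  exact (div_le_iff₀ h2).1 hy

lemma kernel_eq_zero (hsupp : ∀ y, 5 ≤ |y| → ψ y = 0) {x y : ℝ} (hy : 5 / 2 ^ k x ≤ |x - y|) :
    kernel ψ c b k x y = 0 := by
  rw [kernel, psiScale_eq_zero hsupp hy, Complex.ofReal_zero, mul_zero]

lemma kernel_eq_zero_of_notMem (hsupp : ∀ y, 5 ≤ |y| → ψ y = 0) {x y : ℝ} (hx : x ∈ Ico (0 : ℝ) 1)
    (hy : y ∉ Icc (-5 : ℝ) 6) : kernel ψ c b k x y = 0 := by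
  refine kernel_eq_zero hsupp ((div_le_self (by norm_num)
    (one_le_pow₀ (by norm_num))).trans ?_)
  by_contra! h
  rw [abs_lt] at h
  exact hy ⟨by linarith [h.2, hx.1], by linarith [h.1, hx.2]⟩

lemma kernel_mul_conj_kernel_eq_zero (hsupp : ∀ y, 5 ≤ |y| → ψ y = 0) {x x' : ℝ}
    (hk : k x' ≤ k x) (hx : 10 / 2 ^ k x' < |x - x'|) (y : ℝ) :
    kernel ψ c b k x y * conj (kernel ψ c b k x' y) = 0 := by
  rcases le_or_gt (5 / 2 ^ k x) |x - y| with h | h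
  · rw [kernel_eq_zero hsupp h, zero_mul]
  · rw [kernel_eq_zero (x := x') hsupp, map_zero, mul_zero]
    have h1 : (5 : ℝ) / 2 ^ k x ≤ 5 / 2 ^ k x' := by
      gcongr
      norm_num
    have h2 : |x - x'| ≤ |x - y| + |x' - y| := by
      rw [abs_sub_comm x' y]
      exact abs_sub_le x y x'
    have h3 : (10 : ℝ) / 2 ^ k x' = 5 / 2 ^ k x' + 5 / 2 ^ k x' := by ring
    linarith

-- The y-derivative of the phase at x is -l_x(y), so the phase difference is a quadratic whose
-- derivative is the difference of two lines. Taking 2^(-k x) as the unit of length gives one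
-- amplitude factor ψ(s), supported in |s| < 5, and when k x' ≤ k x the other factor varies no
-- faster.
open Complex in
lemma kernel_mul_conj_kernel_rescaled (x x' s : ℝ) :
    kernel ψ c b k x (x - s / 2 ^ k x) * conj (kernel ψ c b k x' (x - s / 2 ^ k x))
      = (exp (I * (-(Line.eval ⟨c x', b x'⟩ x' * (x' - x) - b x' * (x' - x) ^ 2) : ℝ)) *
          ((2 ^ k x * 2 ^ k x' : ℝ) : ℂ)) *
        (exp (I * (((Line.eval ⟨c x, b x⟩ x - Line.eval ⟨c x', b x'⟩ x) / 2 ^ k x * s +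
          (-2 * (b x - b x') / (2 ^ k x) ^ 2) * s ^ 2 / 2 : ℝ) : ℂ)) *
          ((ψ s * ψ (2 ^ k x' * (x' - x) + 2 ^ k x' / 2 ^ k x * s) : ℝ) : ℂ)) := by
  have h2 : (2 : ℝ) ^ k x ≠ 0 := by positivity
  have e1 : psiScale ψ (k x) (x - (x - s / 2 ^ k x)) = 2 ^ k x * ψ s := by
    rw [psiScale]
    congr 2
    field_simp
    ring
  have e2 : psiScale ψ (k x') (x' - (x - s / 2 ^ k x))
      = 2 ^ k x' * ψ (2 ^ k x' * (x' - x) + 2 ^ k x' / 2 ^ k x * s) := by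
    rw [psiScale]
    congr 2
    field_simp
    ring
  have e3 : phase c b x (x - s / 2 ^ k x) - phase c b x' (x - s / 2 ^ k x)
      = -(Line.eval ⟨c x', b x'⟩ x' * (x' - x) - b x' * (x' - x) ^ 2) +
        ((Line.eval ⟨c x, b x⟩ x - Line.eval ⟨c x', b x'⟩ x) / 2 ^ k x * s +
          (-2 * (b x - b x') / (2 ^ k x) ^ 2) * s ^ 2 / 2) := by
    simp only [phase, Line.eval]
    field_simp
    ring
  have e4 : exp (I * (phase c b x (x - s / 2 ^ k x) : ℂ)) *
      exp (-(I * (phase c b x' (x - s / 2 ^ k x) : ℂ)))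
      = exp (I * (-(Line.eval ⟨c x', b x'⟩ x' * (x' - x) - b x' * (x' - x) ^ 2) : ℝ)) *
        exp (I * (((Line.eval ⟨c x, b x⟩ x - Line.eval ⟨c x', b x'⟩ x) / 2 ^ k x * s +
          (-2 * (b x - b x') / (2 ^ k x) ^ 2) * s ^ 2 / 2 : ℝ) : ℂ)) := by
    rw [← exp_add, ← exp_add, ← mul_add, ← ofReal_add, ← e3, ofReal_sub]
    ring_nf
  rw [kernel, kernel, e1, e2, map_mul, ← exp_conj, map_mul, conj_I, conj_ofReal, conj_ofReal,
    neg_mul]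
  push_cast at e4 ⊢
  linear_combination ((2 : ℂ) ^ k x * 2 ^ k x' * (ψ s) *
    (ψ (2 ^ k x' * (x' - x) + 2 ^ k x' / 2 ^ k x * s))) * e4

/-- The correlation of the kernel at two points. -/
lemma norm_integral_kernel_mul_conj_le (hψ : ContDiff ℝ 1 ψ) (hS : ∀ y, |ψ y| ≤ S)
    (hS' : ∀ y, |deriv ψ y| ≤ S) (hsupp : ∀ y, 5 ≤ |y| → ψ y = 0) {x x' : ℝ}
    (hx : x ∈ Ico (0 : ℝ) 1) (hk : k x' ≤ k x) :
    ‖∫ y in Icc (-5 : ℝ) 6, kernel ψ c b k x y * conj (kernel ψ c b k x' y)‖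
        ≤ 240 * S ^ 2 * 2 ^ k x' ∧
      ∀ K : ℝ, 1 ≤ K → ¬ CloseAt K ⟨c x', b x'⟩ c b (k x) x →
        ‖∫ y in Icc (-5 : ℝ) 6, kernel ψ c b k x y * conj (kernel ψ c b k x' y)‖
          ≤ 240 * S ^ 2 * 2 ^ k x' * (1 / √K) := by
  have h2 : (0 : ℝ) < 2 ^ k x := by positivity
  set A := (Line.eval ⟨c x, b x⟩ x - Line.eval ⟨c x', b x'⟩ x) / 2 ^ k x with hA
  set B := -2 * (b x - b x') / (2 ^ k x) ^ 2 with hB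
  set R : ℝ := 2 ^ k x' / 2 ^ k x with hR
  have hR0 : 0 ≤ R := by positivity
  have hR1 : R ≤ 1 := div_le_one_of_le₀ (pow_le_pow_right₀ (by norm_num) hk) h2.le
  set a : ℝ → ℝ := fun s => ψ s * ψ (2 ^ k x' * (x' - x) + R * s) with ha
  set a' : ℝ → ℝ := fun s => deriv ψ s * ψ (2 ^ k x' * (x' - x) + R * s)
    + ψ s * (deriv ψ (2 ^ k x' * (x' - x) + R * s) * R) with ha'
  have key : ‖∫ y in Icc (-5 : ℝ) 6, kernel ψ c b k x y * conj (kernel ψ c b k x' y)‖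
      = 2 ^ k x' * ‖∫ s in (-5 : ℝ)..5,
        Complex.exp (Complex.I * ((A * s + B * s ^ 2 / 2 : ℝ) : ℂ)) * (a s : ℂ)‖ := by
    rw [setIntegral_eq_integral_of_forall_compl_eq_zero fun y hy => by
      rw [kernel_eq_zero_of_notMem hsupp hx hy, zero_mul]]
    set f := fun y => kernel ψ c b k x y * conj (kernel ψ c b k x' y) with hf
    have e1 : ∫ y, f y = |(2 : ℝ) ^ k x|⁻¹ • ∫ s, f (x - s / 2 ^ k x) := by
      rw [← integral_sub_left_eq_self f volume x, Measure.integral_comp_div (fun t => f (x - t)),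
        smul_smul, inv_mul_cancel₀ (by positivity), one_smul]
    have e2 : ∀ s, f (x - s / 2 ^ k x) = _ := fun s => kernel_mul_conj_kernel_rescaled x x' s
    have e3 : (fun s => f (x - s / 2 ^ k x)) = _ := funext e2
    rw [e1, e3, integral_const_mul, norm_smul, norm_mul, norm_mul, mul_comm Complex.I,
      Complex.norm_exp_ofReal_mul_I, Complex.norm_real, one_mul, ← mul_assoc]
    congr 1
    · rw [norm_inv, Real.norm_eq_abs, Real.norm_eq_abs, abs_abs, abs_mul, abs_of_pos h2,
        abs_of_pos (by positivity)]
      field_simp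
    · rw [intervalIntegral.integral_of_le (by norm_num),
        setIntegral_eq_integral_of_forall_compl_eq_zero fun s hs => ?_]
      have : 5 ≤ |s| := by
        by_contra! h
        rw [abs_lt] at h
        exact hs ⟨h.1, h.2.le⟩
      simp [ha, hsupp s this]
  have haD : ∀ s, |a s| ≤ S ^ 2 := fun s => by
    rw [ha, sq]
    simp only
    rw [abs_mul]
    gcongr
    · exact (abs_nonneg _).trans (hS s)
    · exact hS _
    · exact hS _
  have hdψ : ∀ s, HasDerivAt ψ (deriv ψ s) s := fun s =>
    (hψ.differentiable (by norm_num) s).hasDerivAt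
  have hψ'c : Continuous (deriv ψ) := hψ.continuous_deriv (by norm_num)
  have hψc := hψ.continuous
  have had : ∀ s, HasDerivAt a (a' s) s := fun s => by
    have h1 : HasDerivAt (fun s => 2 ^ k x' * (x' - x) + R * s) R s := by
      convert! ((hasDerivAt_id s).const_mul R).const_add (2 ^ k x' * (x' - x)) using 1
      simp
    exact (hdψ s).mul ((hdψ _).comp s h1)
  have hac : Continuous a := by fun_prop
  have ha'c : Continuous a' := by fun_prop
  have ha'D : ∀ s, |a' s| ≤ 2 * S ^ 2 := fun s => by
    rw [ha']
    refine (abs_add_le _ _).trans ?_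
    have hS0 := (abs_nonneg _).trans (hS s)
    rw [abs_mul, abs_mul, abs_mul, abs_of_nonneg hR0]
    calc _ ≤ S * S + S * (S * 1) := by
          gcongr
          · exact hS' _
          · exact hS _
          · exact hS _
          · exact hS' _
      _ = _ := by ring
  rw [key]
  constructor
  · have : ‖∫ s in (-5 : ℝ)..5,
        Complex.exp (Complex.I * ((A * s + B * s ^ 2 / 2 : ℝ) : ℂ)) * (a s : ℂ)‖
        ≤ S ^ 2 * |5 - (-5)| := by
      refine intervalIntegral.norm_integral_le_of_norm_le_const fun s _ => ?_
      rw [norm_mul, mul_comm Complex.I, Complex.norm_exp_ofReal_mul_I, one_mul, Complex.norm_real]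
      exact haD s
    norm_num at this
    calc _ ≤ 2 ^ k x' * (S ^ 2 * 10) := by push_cast; gcongr
      _ ≤ 2 ^ k x' * (S ^ 2 * 240) := by gcongr; norm_num
      _ = _ := by ring
  · intro K hK hcl
    -- The left side of `CloseAt` divided by 2^(k x) is exactly |A| + 5|B|; its coefficient 10 is
    -- chosen for this.
    have hL : K ≤ |A| + 5 * |B| := by
      rw [CloseAt, not_le] at hcl
      have e : |A| + 5 * |B| = (|Line.eval ⟨c x, b x⟩ x - Line.eval ⟨c x', b x'⟩ x|
          + 10 * |b x - b x'| / 2 ^ k x) / 2 ^ k x := by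
        rw [hA, hB, abs_div, abs_div, abs_mul, abs_of_pos h2, abs_of_pos (pow_pos h2 2)]
        norm_num
        ring
      rw [e, le_div_iff₀ h2]
      exact hcl.le
    have := norm_integral_exp_quadratic_le had ha'c (by simp [ha, hsupp]) (by simp [ha, hsupp])
      (fun s => (haD s).trans (by nlinarith [sq_nonneg S])) ha'D hK hL
    calc _ ≤ 2 ^ k x' * (120 * (2 * S ^ 2) / √K) := by gcongr
      _ = _ := by ring

end Kernel

end QuadCarleson

/-! ### The quadratic form of TT*. -/

namespace QuadCarleson

open scoped ENNReal ComplexConjugate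
open Metric

/-- Hölder against the constant 1: small measure becomes a small factor. The exponent 3/2 is below
2, which leaves room for a maximal inequality on L². -/
lemma setLIntegral_le_rpow_mul {X : Type*} [MeasurableSpace X] {μ : Measure X} {f : X → ℝ≥0∞}
    (hf : Measurable f) (s : Set X) :
    ∫⁻ x in s, f x ∂μ ≤ μ s ^ (1 / 3 : ℝ) * (∫⁻ x in s, f x ^ (3 / 2 : ℝ) ∂μ) ^ (2 / 3 : ℝ) := by
  have := ENNReal.lintegral_mul_le_Lp_mul_Lq (μ.restrict s) (p := 3) (q := 3 / 2)
    (by constructor <;> norm_num) (f := 1) aemeasurable_const hf.aemeasurable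
  simpa using this

/-- An integral over a small subset of a ball is controlled by the average of the power `3 / 2`
over that ball. -/
lemma two_pow_mul_setLIntegral_le {f : ℝ → ℝ} (hf : Measurable f)
    {ρ : ℝ → ℝ} {j : ℕ} {x σ : ℝ} (hρ : ρ x = 10 / 2 ^ j) (hσ : 0 ≤ σ) {s : Set ℝ}
    (hs : s ⊆ closedBall x (ρ x)) (hvol : volume s ≤ ENNReal.ofReal (σ / 2 ^ j)) :
    ENNReal.ofReal (2 ^ j) * ∫⁻ t in s, ENNReal.ofReal (f t) ≤ ENNReal.ofReal (5 * σ ^ (1 / 3 : ℝ)) *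
      ballAvg ρ (fun t => ENNReal.ofReal (f t) ^ (3 / 2 : ℝ)) x ^ (2 / 3 : ℝ) := by
  have h2 : (0 : ℝ) < 2 ^ j := by positivity
  have hρ0 : 0 < ρ x := by rw [hρ]; positivity
  set W := ballAvg ρ (fun t => ENNReal.ofReal (f t) ^ (3 / 2 : ℝ)) x with hW
  have h1 : ∫⁻ t in s, ENNReal.ofReal (f t) ^ (3 / 2 : ℝ) ≤ ENNReal.ofReal (10 / 2 ^ j) * W := by
    rw [hW, ballAvg, ← hρ, ENNReal.mul_div_cancel (by simpa using hρ0) (by simp)]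
    exact lintegral_mono_set hs
  have hreal : 2 ^ j * ((σ / 2 ^ j) ^ (1 / 3 : ℝ) * (10 / 2 ^ j) ^ (2 / 3 : ℝ))
      ≤ 5 * σ ^ (1 / 3 : ℝ) := by
    rw [Real.div_rpow hσ h2.le, Real.div_rpow (by norm_num) h2.le]
    have e : ((2 : ℝ) ^ j) ^ (1 / 3 : ℝ) * ((2 : ℝ) ^ j) ^ (2 / 3 : ℝ) = 2 ^ j := by
      rw [← Real.rpow_add h2]
      norm_num
    have h10 : (10 : ℝ) ^ (2 / 3 : ℝ) ≤ 5 := by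
      rw [show (2 / 3 : ℝ) = 2 * (1 / 3) by norm_num, Real.rpow_mul (by norm_num)]
      calc ((10 : ℝ) ^ (2 : ℝ)) ^ (1 / 3 : ℝ) ≤ (5 ^ (3 : ℝ)) ^ (1 / 3 : ℝ) := by
            gcongr
            norm_num
        _ = 5 := by
            rw [← Real.rpow_mul (by norm_num)]
            norm_num
    calc _ = 2 ^ j * (σ ^ (1 / 3 : ℝ) * 10 ^ (2 / 3 : ℝ)) /
          (((2 : ℝ) ^ j) ^ (1 / 3 : ℝ) * ((2 : ℝ) ^ j) ^ (2 / 3 : ℝ)) := by field_simp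
      _ = σ ^ (1 / 3 : ℝ) * 10 ^ (2 / 3 : ℝ) := by rw [e]; field_simp
      _ ≤ σ ^ (1 / 3 : ℝ) * 5 := by gcongr
      _ = _ := mul_comm _ _
  calc ENNReal.ofReal (2 ^ j) * ∫⁻ t in s, ENNReal.ofReal (f t)
      ≤ ENNReal.ofReal (2 ^ j) * (ENNReal.ofReal (σ / 2 ^ j) ^ (1 / 3 : ℝ) *
          (ENNReal.ofReal (10 / 2 ^ j) * W) ^ (2 / 3 : ℝ)) := by
        gcongr
        refine (setLIntegral_le_rpow_mul (by fun_prop) s).trans ?_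
        gcongr
    _ = ENNReal.ofReal (2 ^ j * ((σ / 2 ^ j) ^ (1 / 3 : ℝ) * (10 / 2 ^ j) ^ (2 / 3 : ℝ)))
          * W ^ (2 / 3 : ℝ) := by
        rw [ENNReal.mul_rpow_of_nonneg _ _ (by norm_num),
          ENNReal.ofReal_rpow_of_nonneg (by positivity) (by norm_num),
          ENNReal.ofReal_rpow_of_nonneg (by positivity) (by norm_num), ← mul_assoc, ← mul_assoc,
          ← ENNReal.ofReal_mul h2.le, ← ENNReal.ofReal_mul (by positivity), mul_assoc]
    _ ≤ _ := by gcongr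

/-- Pairing a function with the `L^{3/2}` maximal function of itself. -/
lemma lintegral_mul_ballAvg_rpow_le {ρ : ℝ → ℝ} {R D : ℝ} (hρ : Measurable ρ) (hρ0 : ∀ x, 0 < ρ x)
    (hρR : ∀ x, ρ x ≤ R) {f : ℝ → ℝ} (hf : Measurable f) (hf0 : ∀ x, 0 ≤ f x)
    (hfD : ∀ x, f x ≤ D) :
    ∫⁻ x, ENNReal.ofReal (f x) *
        ballAvg ρ (fun t => ENNReal.ofReal (f t) ^ (3 / 2 : ℝ)) x ^ (2 / 3 : ℝ)
      ≤ 12 * ∫⁻ x, ENNReal.ofReal (f x) ^ 2 := by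
  have hfe : (fun t => ENNReal.ofReal (f t) ^ (3 / 2 : ℝ))
      = fun t => ENNReal.ofReal (f t ^ (3 / 2 : ℝ)) := funext fun t =>
    ENNReal.ofReal_rpow_of_nonneg (hf0 t) (by norm_num)
  have hmax := lintegral_ballAvg_rpow_le hρ hρ0 hρR (f := fun t => f t ^ (3 / 2 : ℝ))
    (B := D ^ (3 / 2 : ℝ)) (by fun_prop) (fun x => Real.rpow_nonneg (hf0 x) _)
    (fun x => Real.rpow_le_rpow (hf0 x) (hfD x) (by norm_num))
  rw [← hfe] at hmax
  set W := ballAvg ρ (fun t => ENNReal.ofReal (f t) ^ (3 / 2 : ℝ)) with hW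
  have hWm : Measurable W := measurable_ballAvg hρ (by fun_prop)
  have e1 : ∀ x, ENNReal.ofReal (f x ^ (3 / 2 : ℝ)) ^ (4 / 3 : ℝ) = ENNReal.ofReal (f x) ^ 2 :=
    fun x => by
      rw [← ENNReal.ofReal_rpow_of_nonneg (hf0 x) (by norm_num), ← ENNReal.rpow_mul]
      norm_num
  simp_rw [e1] at hmax
  have e2 : ∀ x, (W x ^ (2 / 3 : ℝ)) ^ (2 : ℝ) = W x ^ (4 / 3 : ℝ) := fun x => by
    rw [← ENNReal.rpow_mul]
    norm_num
  have hhol := ENNReal.lintegral_mul_le_Lp_mul_Lq volume (p := 2) (q := 2)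
    (by constructor <;> norm_num) (f := fun x => ENNReal.ofReal (f x))
    (g := fun x => W x ^ (2 / 3 : ℝ)) (by fun_prop) (by fun_prop)
  simp_rw [e2] at hhol
  simp only [Pi.mul_apply, ENNReal.rpow_ofNat] at hhol
  set Q := ∫⁻ x, ENNReal.ofReal (f x) ^ 2
  calc _ ≤ _ := hhol
    _ ≤ Q ^ (1 / 2 : ℝ) * (144 * Q) ^ (1 / 2 : ℝ) := by
        gcongr
        refine hmax.trans ?_
        gcongr
        norm_num
    _ = Q ^ (1 / 2 : ℝ) * (12 * Q ^ (1 / 2 : ℝ)) := by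
        rw [ENNReal.mul_rpow_of_nonneg _ _ (by norm_num)]
        congr 2
        rw [show (144 : ℝ≥0∞) = 12 ^ (2 : ℝ) by norm_num, ← ENNReal.rpow_mul]
        norm_num
    _ = 12 * (Q ^ (1 / 2 : ℝ) * Q ^ (1 / 2 : ℝ)) := by ring
    _ = 12 * Q := by
        rw [← ENNReal.rpow_add_of_nonneg _ _ (by norm_num) (by norm_num)]
        norm_num

/-- The points `x` of scale at least `k x'` near `x'` whose line is close to that of `x'`. -/
def closeSet (K : ℝ) (c b : ℝ → ℝ) (k : ℝ → ℕ) (E : Set ℝ) (x' : ℝ) : Set ℝ :=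
  {x | x ∈ E ∧ k x' ≤ k x ∧ |x - x'| ≤ 10 / 2 ^ k x' ∧ CloseAt K ⟨c x', b x'⟩ c b (k x) x}

lemma measurableSet_closeSet {K : ℝ} {c b : ℝ → ℝ} {k : ℝ → ℕ} {E : Set ℝ} (hc : Measurable c)
    (hb : Measurable b) (hk : Measurable k) (hE : MeasurableSet E) :
    MeasurableSet {z : ℝ × ℝ | z.1 ∈ closeSet K c b k E z.2} := by
  have h1 : Measurable fun z : ℝ × ℝ => (2 : ℝ) ^ k z.1 :=
    (measurable_from_top (f := fun m : ℕ => (2 : ℝ) ^ m)).comp (hk.comp measurable_fst)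
  have h2 : Measurable fun z : ℝ × ℝ => (2 : ℝ) ^ k z.2 :=
    (measurable_from_top (f := fun m : ℕ => (2 : ℝ) ^ m)).comp (hk.comp measurable_snd)
  have hb1 : Measurable fun z : ℝ × ℝ => b z.1 := hb.comp measurable_fst
  have hb2 : Measurable fun z : ℝ × ℝ => b z.2 := hb.comp measurable_snd
  have hc1 : Measurable fun z : ℝ × ℝ => c z.1 := hc.comp measurable_fst
  have hc2 : Measurable fun z : ℝ × ℝ => c z.2 := hc.comp measurable_snd
  have habs : ∀ {u : ℝ × ℝ → ℝ}, Measurable u → Measurable fun z => |u z| := fun hu =>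
    continuous_abs.measurable.comp hu
  refine (measurable_fst hE).inter (MeasurableSet.inter ?_ (MeasurableSet.inter ?_ ?_))
  · exact measurableSet_le (hk.comp measurable_snd) (hk.comp measurable_fst)
  · exact measurableSet_le (habs (by fun_prop)) (by fun_prop)
  · refine measurableSet_le (Measurable.add (habs ?_)
      (((habs (by fun_prop)).const_mul _).div h1)) (by fun_prop)
    simp only [Line.eval]
    fun_prop

section Form

variable {ψ c b : ℝ → ℝ} {k : ℝ → ℕ} {S K θ : ℝ} {n : ℕ} {E : Set ℝ}

/-- Three regimes: disjoint supports, close lines (trivial bound), and separated lines (van der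
Corput). Everything is normalised by the coarser scale k x'. -/
lemma enorm_kernel_correlation_le (hψ : ContDiff ℝ 1 ψ) (hS : ∀ y, |ψ y| ≤ S)
    (hS' : ∀ y, |deriv ψ y| ≤ S) (hsupp : ∀ y, 5 ≤ |y| → ψ y = 0) (hE : E ⊆ Ico 0 1)
    (hK : 1 ≤ K) {x x' : ℝ} (hx : x ∈ E) (hk : k x' ≤ k x) :
    ‖∫ y in Icc (-5 : ℝ) 6, kernel ψ c b k x y * conj (kernel ψ c b k x' y)‖ₑ
      ≤ ENNReal.ofReal (240 * S ^ 2) * (ENNReal.ofReal (2 ^ k x') *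
        (ENNReal.ofReal (1 / √K) * (closedBall x' (10 / 2 ^ k x')).indicator 1 x
          + (closeSet K c b k E x').indicator 1 x)) := by
  obtain ⟨h1, h2⟩ := norm_integral_kernel_mul_conj_le (c := c) (b := b) hψ hS hS' hsupp
    (hE hx) hk
  rcases lt_or_ge (10 / 2 ^ k x') |x - x'| with hd | hd
  · simp_rw [kernel_mul_conj_kernel_eq_zero hsupp hk hd]
    simp
  have hb : x ∈ closedBall x' (10 / 2 ^ k x') := by
    rwa [mem_closedBall, Real.dist_eq]
  rw [← ofReal_norm, indicator_of_mem hb, Pi.one_apply, mul_one, ← mul_assoc,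
    ← ENNReal.ofReal_mul (by positivity)]
  by_cases hcl : CloseAt K ⟨c x', b x'⟩ c b (k x) x
  · rw [indicator_of_mem (show x ∈ closeSet K c b k E x' from ⟨hx, hk, hd, hcl⟩), Pi.one_apply]
    calc _ ≤ ENNReal.ofReal (240 * S ^ 2 * 2 ^ k x') * 1 := by
          rw [mul_one]
          exact ENNReal.ofReal_le_ofReal h1
      _ ≤ _ := by gcongr; exact le_add_self
  · calc _ ≤ ENNReal.ofReal (240 * S ^ 2 * 2 ^ k x') * ENNReal.ofReal (1 / √K) := by
          rw [← ENNReal.ofReal_mul (by positivity)]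
          exact ENNReal.ofReal_le_ofReal (h2 K hK hcl)
      _ ≤ _ := by gcongr; exact le_self_add

/-- The quadratic form bound for the kernel of `T T*`. -/
lemma kernel_form_le (hψ : ContDiff ℝ 1 ψ) (hS : ∀ y, |ψ y| ≤ S)
    (hS' : ∀ y, |deriv ψ y| ≤ S) (hsupp : ∀ y, 5 ≤ |y| → ψ y = 0) (hc : Measurable c)
    (hb : Measurable b) (hkm : Measurable k) (hEm : MeasurableSet E)
    (hE : E ⊆ Ico 0 1) (hK : 1 ≤ K) (hθ : 0 ≤ θ)
    (hG : ∀ x' ∈ E, volume (closeSet K c b k E x') ≤ ENNReal.ofReal (θ / 2 ^ k x'))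
    {g : ℝ → ℝ} (hg : Measurable g) (hg0 : ∀ x, 0 ≤ g x) (hgD : ∃ D, ∀ x, g x ≤ D) :
    ∫⁻ x in E, ∫⁻ x' in E, ENNReal.ofReal (g x) * ENNReal.ofReal (g x') *
        ‖∫ y in Icc (-5 : ℝ) 6, kernel ψ c b k x y * conj (kernel ψ c b k x' y)‖ₑ
      ≤ ENNReal.ofReal (86400 * S ^ 2 * (1 / √K + θ ^ (1 / 3 : ℝ))) *
        ∫⁻ x in E, ENNReal.ofReal (g x) ^ 2 := by
  obtain ⟨D, hD⟩ := hgD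
  set Φ : ℝ → ℝ → ℝ≥0∞ := fun x x' => ENNReal.ofReal (2 ^ k x') *
    (ENNReal.ofReal (1 / √K) * (closedBall x' (10 / 2 ^ k x')).indicator 1 x
      + (closeSet K c b k E x').indicator 1 x) with hΦ
  set T : ℝ → ℝ → ℝ≥0∞ := fun x x' =>
    ‖∫ y in Icc (-5 : ℝ) 6, kernel ψ c b k x y * conj (kernel ψ c b k x' y)‖ₑ with hT
  have hTsymm : ∀ x x', T x x' = T x' x := fun x x' => by
    simp only [hT]
    rw [← RCLike.enorm_conj, ← integral_conj]
    simp only [map_mul, Complex.conj_conj, mul_comm]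
  -- Each pair is charged to its point of coarser scale. By symmetry only one of the two resulting
  -- integrals has to be estimated.
  have hTΦ : ∀ x ∈ E, ∀ x' ∈ E, T x x' ≤ ENNReal.ofReal (240 * S ^ 2) * (Φ x x' + Φ x' x) := by
    intro x hx x' hx'
    rcases le_total (k x') (k x) with h | h
    · refine (enorm_kernel_correlation_le hψ hS hS' hsupp hE hK hx h).trans ?_
      gcongr
      exact le_self_add
    · rw [hTsymm]
      refine (enorm_kernel_correlation_le hψ hS hS' hsupp hE hK hx' h).trans ?_
      gcongr
      exact le_add_self
  set ρ : ℝ → ℝ := fun x => 10 / 2 ^ k x with hρ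
  have h2k : Measurable fun x => (2 : ℝ) ^ k x :=
    (measurable_from_top (f := fun m : ℕ => (2 : ℝ) ^ m)).comp hkm
  have hρm : Measurable ρ := h2k.const_div _
  have hΦm : Measurable (Function.uncurry Φ) := by
    refine Measurable.mul (by fun_prop) (Measurable.add (Measurable.const_mul ?_ _) ?_)
    · have : MeasurableSet {z : ℝ × ℝ | dist z.1 z.2 ≤ ρ z.2} :=
        measurableSet_le (by fun_prop) (by fun_prop)
      exact (measurable_one.indicator this : Measurable ({z : ℝ × ℝ | dist z.1 z.2 ≤ ρ z.2}.indicator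
        (1 : ℝ × ℝ → ℝ≥0∞)))
    · exact (measurable_one.indicator (measurableSet_closeSet hc hb hkm hEm) :
        Measurable ({z : ℝ × ℝ | z.1 ∈ closeSet K c b k E z.2}.indicator (1 : ℝ × ℝ → ℝ≥0∞)))
  have hρ0 : ∀ x, 0 < ρ x := fun x => by simp only [hρ]; positivity
  set f : ℝ → ℝ := E.indicator g with hf
  have hfm : Measurable f := hg.indicator hEm
  have hf0 : ∀ x, 0 ≤ f x := fun x => indicator_nonneg (fun x _ => hg0 x) x
  have hfD : ∀ x, f x ≤ D := fun x => indicator_apply_le' (fun _ => hD x)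
    fun _ => (hg0 x).trans (hD x)
  have hfg : ∀ x, ENNReal.ofReal (f x) = E.indicator (fun x => ENNReal.ofReal (g x)) x := fun x => by
    by_cases h : x ∈ E <;> simp [hf, h]
  set W := ballAvg ρ (fun t => ENNReal.ofReal (f t) ^ (3 / 2 : ℝ)) with hW
  -- Both terms come from `two_pow_mul_setLIntegral_le`: the whole ball, where σ = 20 and 5 ·
  -- 20^(1/3) ≤ 15, and the close set, where σ = θ.
  set κ : ℝ := 15 * (1 / √K) + 5 * θ ^ (1 / 3 : ℝ) with hκ
  have hinner : ∀ x' ∈ E, ∫⁻ x in E, ENNReal.ofReal (g x) * Φ x x'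
      ≤ ENNReal.ofReal κ * W x' ^ (2 / 3 : ℝ) := by
    intro x' hx'
    have hcm : MeasurableSet (closeSet K c b k E x') :=
      measurable_prodMk_right (y := x') (measurableSet_closeSet hc hb hkm hEm)
    have e1 : ∫⁻ x in E, ENNReal.ofReal (g x) * Φ x x'
        = ∫⁻ x, ENNReal.ofReal (f x) * Φ x x' := by
      rw [← lintegral_indicator hEm]
      refine lintegral_congr fun x => ?_
      rw [hfg, indicator_mul_left]
    have e2 : ∀ x, ENNReal.ofReal (f x) * Φ x x' = ENNReal.ofReal (2 ^ k x') *
        (ENNReal.ofReal (1 / √K) *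
          (closedBall x' (ρ x')).indicator (fun x => ENNReal.ofReal (f x)) x
        + (closeSet K c b k E x').indicator (fun x => ENNReal.ofReal (f x)) x) := fun x => by
      simp only [hΦ, hρ]
      by_cases h1 : x ∈ closedBall x' (10 / 2 ^ k x') <;>
      by_cases h2 : x ∈ closeSet K c b k E x' <;> simp [h1, h2] <;> ring
    rw [e1]
    simp_rw [e2]
    have hmB : Measurable ((closedBall x' (ρ x')).indicator fun x => ENNReal.ofReal (f x)) :=
      Measurable.indicator (by fun_prop) measurableSet_closedBall
    rw [lintegral_const_mul' _ _ ENNReal.ofReal_ne_top, lintegral_add_left (hmB.const_mul _),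
      lintegral_const_mul' _ _ ENNReal.ofReal_ne_top, lintegral_indicator measurableSet_closedBall,
      lintegral_indicator hcm, mul_add, mul_left_comm, hκ, ENNReal.ofReal_add (by positivity)
        (by positivity), add_mul]
    refine add_le_add ?_ ?_
    · have h20 : (20 : ℝ) ^ (1 / 3 : ℝ) ≤ 3 := by
        calc (20 : ℝ) ^ (1 / 3 : ℝ) ≤ (3 ^ (3 : ℝ)) ^ (1 / 3 : ℝ) := by
              gcongr
              norm_num
          _ = 3 := by
              rw [← Real.rpow_mul (by norm_num)]
              norm_num
      have := two_pow_mul_setLIntegral_le hfm (ρ := ρ) (j := k x') (x := x') (σ := 20) rfl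
        (by norm_num) (subset_refl _) (by
          rw [Real.volume_closedBall]
          exact ENNReal.ofReal_le_ofReal (by simp only [hρ]; apply le_of_eq; ring))
      calc _ ≤ ENNReal.ofReal (1 / √K) * (ENNReal.ofReal (5 * 3) * W x' ^ (2 / 3 : ℝ)) := by
            refine mul_le_mul_right (this.trans ?_) _
            gcongr
        _ = _ := by
            rw [← mul_assoc, ← ENNReal.ofReal_mul (by positivity)]
            congr 2
            ring
    · refine two_pow_mul_setLIntegral_le hfm (ρ := ρ) (j := k x') (x := x') (σ := θ) rfl hθ
        (s := closeSet K c b k E x') (fun x hx => ?_) (hG x' hx')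
      rw [mem_closedBall, Real.dist_eq]
      exact hx.2.2.1
  have hhalf : ∫⁻ x' in E, ∫⁻ x in E, ENNReal.ofReal (g x) * ENNReal.ofReal (g x') * Φ x x'
      ≤ ENNReal.ofReal (12 * κ) * ∫⁻ x in E, ENNReal.ofReal (g x) ^ 2 := by
    calc _ ≤ ∫⁻ x' in E, ENNReal.ofReal (g x') * (ENNReal.ofReal κ * W x' ^ (2 / 3 : ℝ)) := by
          refine setLIntegral_mono' hEm fun x' hx' => ?_
          have : ∀ x, ENNReal.ofReal (g x) * ENNReal.ofReal (g x') * Φ x x'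
              = ENNReal.ofReal (g x') * (ENNReal.ofReal (g x) * Φ x x') := fun x => by ring
          simp_rw [this]
          rw [lintegral_const_mul' _ _ ENNReal.ofReal_ne_top]
          gcongr
          exact hinner x' hx'
      _ = ENNReal.ofReal κ * ∫⁻ x, ENNReal.ofReal (f x) * W x ^ (2 / 3 : ℝ) := by
          rw [← lintegral_indicator hEm, ← lintegral_const_mul' _ _ ENNReal.ofReal_ne_top]
          refine lintegral_congr fun x => ?_
          rw [hfg]
          by_cases h : x ∈ E <;> simp [h]
          ring
      _ ≤ ENNReal.ofReal κ * (12 * ∫⁻ x, ENNReal.ofReal (f x) ^ 2) := by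
          gcongr
          exact lintegral_mul_ballAvg_rpow_le hρm hρ0 (R := 10) (fun x => div_le_self (by norm_num)
            (one_le_pow₀ (by norm_num))) hfm hf0 hfD
      _ = _ := by
          rw [← mul_assoc, mul_comm (ENNReal.ofReal κ), ENNReal.ofReal_mul (by norm_num),
            ENNReal.ofReal_ofNat, ← lintegral_indicator hEm]
          congr 1
          refine lintegral_congr fun x => ?_
          rw [hfg]
          by_cases h : x ∈ E <;> simp [h]
  have hmeas : Measurable (Function.uncurry fun x x' =>
      ENNReal.ofReal (g x) * ENNReal.ofReal (g x') * Φ x x') := by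
    have h1 : Measurable fun z : ℝ × ℝ => g z.1 := hg.comp measurable_fst
    have h2 : Measurable fun z : ℝ × ℝ => g z.2 := hg.comp measurable_snd
    exact (h1.ennreal_ofReal.mul h2.ennreal_ofReal).mul hΦm
  calc ∫⁻ x in E, ∫⁻ x' in E, ENNReal.ofReal (g x) * ENNReal.ofReal (g x') * T x x'
      ≤ ∫⁻ x in E, ∫⁻ x' in E, ENNReal.ofReal (240 * S ^ 2) *
          (ENNReal.ofReal (g x) * ENNReal.ofReal (g x') * Φ x x' +
            ENNReal.ofReal (g x') * ENNReal.ofReal (g x) * Φ x' x) := by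
        refine setLIntegral_mono' hEm fun x hx => setLIntegral_mono' hEm fun x' hx' => ?_
        calc _ ≤ ENNReal.ofReal (g x) * ENNReal.ofReal (g x') *
              (ENNReal.ofReal (240 * S ^ 2) * (Φ x x' + Φ x' x)) := by
              gcongr
              exact hTΦ x hx x' hx'
          _ = _ := by ring
    _ = ENNReal.ofReal (240 * S ^ 2) *
          ((∫⁻ x in E, ∫⁻ x' in E, ENNReal.ofReal (g x) * ENNReal.ofReal (g x') * Φ x x') +
          ∫⁻ x in E, ∫⁻ x' in E, ENNReal.ofReal (g x') * ENNReal.ofReal (g x) * Φ x' x) := by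
        have hadd := lintegral_add_left (μ := volume.restrict E)
          (hmeas.lintegral_prod_right' (ν := volume.restrict E)) (fun x => ∫⁻ x' in E,
            ENNReal.ofReal (g x') * ENNReal.ofReal (g x) * Φ x' x)
        simp only [Function.uncurry] at hadd
        rw [← hadd, ← lintegral_const_mul' _ _ ENNReal.ofReal_ne_top]
        refine lintegral_congr fun x => ?_
        have hx : Measurable fun x' => ENNReal.ofReal (g x) * ENNReal.ofReal (g x') * Φ x x' :=
          hmeas.comp measurable_prodMk_left
        rw [lintegral_const_mul' _ _ ENNReal.ofReal_ne_top, lintegral_add_left hx]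
    _ ≤ ENNReal.ofReal (240 * S ^ 2) *
          (ENNReal.ofReal (12 * κ) * (∫⁻ x in E, ENNReal.ofReal (g x) ^ 2) +
            ENNReal.ofReal (12 * κ) * ∫⁻ x in E, ENNReal.ofReal (g x) ^ 2) := by
        gcongr
        rw [lintegral_lintegral_swap hmeas.aemeasurable]
        exact hhalf
    _ = ENNReal.ofReal (240 * S ^ 2 * (24 * κ)) * ∫⁻ x in E, ENNReal.ofReal (g x) ^ 2 := by
        rw [← add_mul, ← ENNReal.ofReal_add (by positivity) (by positivity), ← mul_assoc,
          ← ENNReal.ofReal_mul (by positivity)]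
        ring_nf
    _ ≤ _ := by
        refine mul_le_mul_left (ENNReal.ofReal_le_ofReal ?_) _
        have h1 : 0 ≤ θ ^ (1 / 3 : ℝ) := Real.rpow_nonneg hθ _
        have h3 : κ ≤ 15 * (1 / √K + θ ^ (1 / 3 : ℝ)) := by
          rw [hκ]
          linarith
        calc 240 * S ^ 2 * (24 * κ) ≤ 240 * S ^ 2 * (24 * (15 * (1 / √K + θ ^ (1 / 3 : ℝ)))) := by
              gcongr
          _ = _ := by ring

/-- The `L²` bound for the linearized operator. -/
lemma lintegral_kernel_sq_le (hψ : ContDiff ℝ 1 ψ) (hS : ∀ y, |ψ y| ≤ S)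
    (hS' : ∀ y, |deriv ψ y| ≤ S) (hsupp : ∀ y, 5 ≤ |y| → ψ y = 0) (hc : Measurable c)
    (hb : Measurable b) (hkm : Measurable k) (hkn : ∀ x, k x ≤ n) (hEm : MeasurableSet E)
    (hE : E ⊆ Ico 0 1) (hK : 1 ≤ K) (hθ : 0 ≤ θ)
    (hG : ∀ x' ∈ E, volume (closeSet K c b k E x') ≤ ENNReal.ofReal (θ / 2 ^ k x'))
    {F : ℝ → ℂ} (hF : MemLp F 2 (volume.restrict (Icc (-5 : ℝ) 6))) :
    ∫⁻ x in E, ‖∫ y in Icc (-5 : ℝ) 6, kernel ψ c b k x y * F y‖ₑ ^ 2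
      ≤ ENNReal.ofReal (86400 * S ^ 2 * (1 / √K + θ ^ (1 / 3 : ℝ))) *
        ∫⁻ y in Icc (-5 : ℝ) 6, ‖F y‖ₑ ^ 2 := by
  have : IsFiniteMeasure (volume.restrict E) :=
    ⟨by
      rw [Measure.restrict_apply_univ]
      exact (measure_mono hE).trans_lt (by simp)⟩
  exact lintegral_enorm_integral_sq_le (measurable_kernel hψ.continuous.measurable hc hb hkm)
    (norm_kernel_le hS hkn) (fun g hg hg0 hgD =>
      kernel_form_le hψ hS hS' hsupp hc hb hkm hEm hE hK hθ hG hg hg0 hgD) hF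

end Form

end QuadCarleson

/-! ### From incomparable tiles to a single kernel. -/

namespace QuadCarleson

open scoped ENNReal ComplexConjugate

section Family

variable {ψ c b : ℝ → ℝ} {N M r : ℕ} {S δ : ℝ}

lemma measurableSet_tileE (hc : Measurable c) (hb : Measurable b) (P : Tile) :
    MeasurableSet (tileE c b P) := by
  have h : ∀ t : ℝ, Measurable fun x => Line.eval ⟨c x, b x⟩ t := fun t => by
    simp only [Line.eval]
    fun_prop
  exact measurableSet_Ico.inter ((h _ measurableSet_Ico).inter (h _ measurableSet_Ico))

/-- Two tiles whose sets `E(P)` meet are comparable. -/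
lemma le_or_le_of_mem_tileE {P Q : Tile} {x : ℝ} (hP : x ∈ tileE c b P) (hQ : x ∈ tileE c b Q) :
    P.Le Q ∨ Q.Le P := by
  have key : ∀ {P Q : Tile}, x ∈ tileE c b P → x ∈ tileE c b Q → Q.k ≤ P.k → P.Le Q := by
    intro P Q hP hQ hk
    refine ⟨fun y hy => ?_, ⟨c x, b x⟩, hQ.2, hP.2⟩
    have hy' : y ∈ P.I := hy
    have h1 := Tile.mem_I.1 hQ.1
    rw [Tile.mem_I, ← Tile.mem_I.1 hP.1] at hy'
    exact Tile.mem_I.2 ((floor_mul_two_pow_eq hk hy').trans h1)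
  rcases le_total Q.k P.k with h | h
  · exact Or.inl (key hP hQ h)
  · exact Or.inr (key hQ hP h)

/-- Incomparability enters the argument only through this disjointness. -/
lemma disjoint_tileE {𝒬 : Set Tile} (h𝒬 : ∀ P ∈ 𝒬, ∀ Q ∈ 𝒬, P ≠ Q → ¬ P.Le Q) {P Q : Tile}
    (hP : P ∈ 𝒬) (hQ : Q ∈ 𝒬) (hPQ : P ≠ Q) : Disjoint (tileE c b P) (tileE c b Q) := by
  rw [Set.disjoint_left]
  intro x hxP hxQ
  rcases le_or_le_of_mem_tileE hxP hxQ with h | h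
  · exact h𝒬 P hP Q hQ hPQ h
  · exact h𝒬 Q hQ P hP hPQ.symm h

/-- The exponent of K is chosen so that K^(N+2) δ = δ^(1/2). The second term is then O(δ^(1/6)),
dominated by δ^(1/(4(N+2))) because 4(N + 2) ≥ 6 and δ ≤ 1. -/
lemma scale_bound {δ : ℝ} (hδ : 0 < δ) (hδ1 : δ ≤ 1) (N M : ℕ) :
    1 / √(δ ^ (-(1 / (2 * (N + 2))) : ℝ)) +
      (84 * 2 ^ M * (1 + δ ^ (-(1 / (2 * (N + 2))) : ℝ)) ^ (N + 2) * δ) ^ (1 / 3 : ℝ)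
      ≤ (1 + 84 * 2 ^ M * 2 ^ (N + 2)) * δ ^ (1 / (4 * (N + 2)) : ℝ) := by
  set K : ℝ := δ ^ (-(1 / (2 * (N + 2))) : ℝ) with hK
  have hN : (0 : ℝ) < N + 2 := by positivity
  have hK0 : 0 < K := Real.rpow_pos_of_pos hδ _
  have hK1 : 1 ≤ K := Real.one_le_rpow_of_pos_of_le_one_of_nonpos hδ hδ1
    (neg_nonpos.2 (by positivity))
  have h1 : 1 / √K = δ ^ (1 / (4 * (N + 2)) : ℝ) := by
    rw [hK, Real.sqrt_eq_rpow, ← Real.rpow_mul hδ.le, one_div, ← Real.rpow_neg hδ.le]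
    congr 1
    field_simp
    norm_num
  have h2 : (1 + K) ^ (N + 2) * δ ≤ 2 ^ (N + 2) * δ ^ (1 / 2 : ℝ) := by
    have h3 : K ^ (N + 2) * δ = δ ^ (1 / 2 : ℝ) := by
      rw [hK, ← Real.rpow_natCast, ← Real.rpow_mul hδ.le, ← Real.rpow_add_one hδ.ne']
      congr 1
      push_cast
      field_simp
      norm_num
    calc (1 + K) ^ (N + 2) * δ ≤ (2 * K) ^ (N + 2) * δ := by
          gcongr
          linarith
      _ = 2 ^ (N + 2) * (K ^ (N + 2) * δ) := by rw [mul_pow]; ring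
      _ = _ := by rw [h3]
  have hA : (1 : ℝ) ≤ 84 * 2 ^ M * 2 ^ (N + 2) := by
    have : (1 : ℝ) ≤ 2 ^ M := one_le_pow₀ (by norm_num)
    have : (1 : ℝ) ≤ 2 ^ (N + 2) := one_le_pow₀ (by norm_num)
    nlinarith
  have h4 : (84 * 2 ^ M * (1 + K) ^ (N + 2) * δ) ^ (1 / 3 : ℝ)
      ≤ 84 * 2 ^ M * 2 ^ (N + 2) * δ ^ (1 / (4 * (N + 2)) : ℝ) := by
    calc _ ≤ (84 * 2 ^ M * 2 ^ (N + 2) * δ ^ (1 / 2 : ℝ)) ^ (1 / 3 : ℝ) := by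
          refine Real.rpow_le_rpow (by positivity) ?_ (by norm_num)
          calc _ = 84 * 2 ^ M * ((1 + K) ^ (N + 2) * δ) := by ring
            _ ≤ 84 * 2 ^ M * (2 ^ (N + 2) * δ ^ (1 / 2 : ℝ)) := by gcongr
            _ = _ := by ring
      _ = (84 * 2 ^ M * 2 ^ (N + 2)) ^ (1 / 3 : ℝ) * δ ^ (1 / 6 : ℝ) := by
          rw [Real.mul_rpow (by positivity) (Real.rpow_nonneg hδ.le _), ← Real.rpow_mul hδ.le]
          norm_num
      _ ≤ 84 * 2 ^ M * 2 ^ (N + 2) * δ ^ (1 / (4 * (N + 2)) : ℝ) := by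
          refine mul_le_mul ?_ ?_ (Real.rpow_nonneg hδ.le _) (by positivity)
          · exact (Real.rpow_le_rpow_of_exponent_le hA (by norm_num)).trans_eq (Real.rpow_one _)
          · refine Real.rpow_le_rpow_of_exponent_ge hδ hδ1 ?_
            rw [div_le_div_iff₀ (by positivity) (by norm_num)]
            have : (0 : ℝ) ≤ N := by positivity
            linarith
  rw [h1]
  calc _ ≤ δ ^ (1 / (4 * (N + 2)) : ℝ) +
        84 * 2 ^ M * 2 ^ (N + 2) * δ ^ (1 / (4 * (N + 2)) : ℝ) := by gcongr
    _ = _ := by ring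

/-- The `L²` bound for a finite family of incomparable tiles, on the real line. -/
lemma sum_lintegral_tileE_le (hψ : ContDiff ℝ 1 ψ) (hS : ∀ y, |ψ y| ≤ S)
    (hS' : ∀ y, |deriv ψ y| ≤ S) (hsupp : ∀ y, 5 ≤ |y| → ψ y = 0) (hc : Measurable c)
    (hb : Measurable b) (hM : 1 ≤ M) (hδ : 0 < δ) (hδ1 : δ ≤ 1) (𝒬 : Finset Tile)
    (hsp : ∀ P ∈ 𝒬, P ∈ sparseTiles M r) (h𝒬 : ∀ P ∈ 𝒬, ∀ Q ∈ 𝒬, P ≠ Q → ¬ P.Le Q)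
    (hm : ∀ P ∈ 𝒬, mass (sparseTiles M r) N c b P ≤ δ)
    {F : ℝ → ℂ} (hF : MemLp F 2 (volume.restrict (Icc (-5 : ℝ) 6))) :
    ∑ P ∈ 𝒬, ∫⁻ x in tileE c b P,
        ‖∫ y in Icc (-5 : ℝ) 6, kernel ψ c b (fun _ => P.k) x y * F y‖ₑ ^ 2
      ≤ ENNReal.ofReal (86400 * S ^ 2 * ((1 + 84 * 2 ^ M * 2 ^ (N + 2)) *
          δ ^ (1 / (4 * (N + 2)) : ℝ))) * ∫⁻ y in Icc (-5 : ℝ) 6, ‖F y‖ₑ ^ 2 := by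
  classical
  set E := ⋃ P ∈ 𝒬, tileE c b P with hE
  -- By disjointness at most one summand is nonzero, so this is the scale of the tile active at x.
  -- Finiteness of the family bounds k, hence the kernel, but the final constant does not see this
  -- bound.
  set k : ℝ → ℕ := fun x => ∑ P ∈ 𝒬, (tileE c b P).indicator (fun _ => P.k) x with hk
  have hEm : MeasurableSet E := 𝒬.measurableSet_biUnion fun P _ => measurableSet_tileE hc hb P
  have hdisj : ∀ P ∈ 𝒬, ∀ Q ∈ 𝒬, P ≠ Q → Disjoint (tileE c b P) (tileE c b Q) :=
    fun P hP Q hQ hPQ => disjoint_tileE (𝒬 := (𝒬 : Set Tile)) h𝒬 hP hQ hPQ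
  have hkm : Measurable k :=
    Finset.measurable_fun_sum _ fun P _ => measurable_const.indicator (measurableSet_tileE hc hb P)
  have hkP : ∀ P ∈ 𝒬, ∀ x ∈ tileE c b P, k x = P.k := by
    intro P hP x hx
    simp only [hk]
    rw [Finset.sum_eq_single_of_mem P hP, indicator_of_mem hx]
    intro Q hQ hQP
    exact indicator_of_notMem (fun hxQ => Set.disjoint_left.1 (hdisj Q hQ P hP hQP) hxQ hx) _
  have hkn : ∀ x, k x ≤ ∑ P ∈ 𝒬, P.k := fun x =>
    Finset.sum_le_sum fun P _ => indicator_le_self (tileE c b P) (fun _ => P.k) x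
  have hE01 : E ⊆ Ico 0 1 := iUnion₂_subset fun P _ x hx => P.I_subset hx.1
  set K : ℝ := δ ^ (-(1 / (2 * (N + 2))) : ℝ) with hK
  have hK1 : 1 ≤ K := Real.one_le_rpow_of_pos_of_le_one_of_nonpos hδ hδ1
    (neg_nonpos.2 (by positivity))
  set θ : ℝ := 84 * 2 ^ M * (1 + K) ^ (N + 2) * δ with hθ
  have hθ0 : 0 ≤ θ := by positivity
  have hG : ∀ x' ∈ E, volume (closeSet K c b k E x') ≤ ENNReal.ofReal (θ / 2 ^ k x') := by
    intro x' _
    have hclose : IsCloseSet M r N c b K δ ⟨c x', b x'⟩ k (∑ P ∈ 𝒬, P.k)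
        (closeSet K c b k E x') := by
      intro x hx
      obtain ⟨P, hP, hxP⟩ := mem_iUnion₂.1 hx.1
      exact ⟨hkn x, hx.2.2.2, P, (hkP P hP x hxP).symm, hsp P hP, hm P hP, hxP⟩
    exact hclose.volume_le hM (by linarith) hδ.le (fun x hx => hx.2.1) fun x hx => hx.2.2.1
  calc _ = ∑ P ∈ 𝒬, ∫⁻ x in tileE c b P,
        ‖∫ y in Icc (-5 : ℝ) 6, kernel ψ c b k x y * F y‖ₑ ^ 2 := by
        refine Finset.sum_congr rfl fun P hP =>
          setLIntegral_congr_fun (measurableSet_tileE hc hb P) fun x hx => ?_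
        simp only [kernel, hkP P hP x hx]
    _ = ∫⁻ x in E, ‖∫ y in Icc (-5 : ℝ) 6, kernel ψ c b k x y * F y‖ₑ ^ 2 :=
        (lintegral_biUnion_finset (fun P hP Q hQ hPQ => hdisj P hP Q hQ hPQ)
          (fun P _ => measurableSet_tileE hc hb P) _).symm
    _ ≤ _ := lintegral_kernel_sq_le hψ hS hS' hsupp hc hb hkm hkn hEm hE01 hK1 hθ0 hG hF
    _ ≤ _ := by
        refine mul_le_mul_left (ENNReal.ofReal_le_ofReal ?_) _
        gcongr
        exact scale_bound hδ hδ1 N M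

/-- For |y| ≤ 1/2 and k ≤ 3 one has 2^k |y| ≤ 4, where ψ vanishes. From k = 4 on, 5/2^k < 1/2 and
the truncation at 1/2 cuts nothing off, so the integral can be taken over the line. -/
lemma tileOp_eq_zero_of_k_le (hsupp4 : ∀ y, |y| ≤ 4 → ψ y = 0) {P : Tile} (hP : P.k ≤ 3)
    (f : UnitAddCircle → ℂ) (x : ℝ) : tileOp ψ c b P f x = 0 := by
  unfold tileOp
  refine indicator_apply_eq_zero.2 fun _ => ?_
  refine (intervalIntegral.integral_congr (g := fun _ => 0) fun y hy => ?_).trans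
    intervalIntegral.integral_zero
  rw [uIcc_of_le (by norm_num)] at hy
  have h1 : psiScale ψ P.k y = 0 := by
    rw [psiScale, hsupp4, mul_zero]
    rw [abs_mul, abs_of_pos (by positivity)]
    have h2 : (2 : ℝ) ^ P.k ≤ 2 ^ 3 := pow_le_pow_right₀ (by norm_num) hP
    have h3 : |y| ≤ 1 / 2 := abs_le.2 hy
    calc (2 : ℝ) ^ P.k * |y| ≤ 2 ^ 3 * (1 / 2) := by gcongr
      _ = 4 := by norm_num
  simp [h1]

lemma tileOp_eq_integral_kernel (hsupp : ∀ y, 5 ≤ |y| → ψ y = 0) {P : Tile} (hP : 4 ≤ P.k)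
    (f : UnitAddCircle → ℂ) {x : ℝ} (hx : x ∈ tileE c b P) :
    tileOp ψ c b P f x = ∫ y in Icc (-5 : ℝ) 6, kernel ψ c b (fun _ => P.k) x y * f y := by
  have hx01 := P.I_subset hx.1
  unfold tileOp
  rw [indicator_of_mem hx, intervalIntegral.integral_of_le (by norm_num),
    setIntegral_eq_integral_of_forall_compl_eq_zero fun y hy => ?_,
    setIntegral_eq_integral_of_forall_compl_eq_zero fun y hy => ?_,
    ← integral_sub_left_eq_self _ volume x]
  · refine integral_congr_ae (Filter.Eventually.of_forall fun y => ?_)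
    simp only [kernel, phase, sub_sub_cancel]
  · rw [kernel_eq_zero_of_notMem hsupp hx01 hy, zero_mul]
  · have h1 : psiScale ψ P.k y = 0 := by
      refine psiScale_eq_zero hsupp ?_
      have h2 : (2 : ℝ) ^ 4 ≤ 2 ^ P.k := pow_le_pow_right₀ (by norm_num) hP
      have h3 : (5 : ℝ) / 2 ^ P.k ≤ 5 / 2 ^ 4 := by gcongr
      have h4 : 1 / 2 ≤ |y| := by
        by_contra! h
        rw [abs_lt] at h
        exact hy ⟨h.1, h.2.le⟩
      norm_num at h3
      linarith
    simp [h1]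

end Family

end QuadCarleson

/-! ### Infinite families and the passage to the circle. -/

namespace QuadCarleson

open scoped ENNReal ComplexConjugate

instance : Countable Tile :=
  Function.Injective.countable (f := fun P : Tile => (P.k, P.i, P.u, P.v)) fun P Q h => by
    simp only [Prod.mk.injEq] at h
    exact Tile.ext h.1 h.2.1 h.2.2.1 h.2.2.2

lemma hasSum_and_enorm_tsum_sq {ι : Type*} {a : ι → ℂ}
    (h : ∀ i j, a i ≠ 0 → a j ≠ 0 → i = j) :
    HasSum a (∑' i, a i) ∧ ‖∑' i, a i‖ₑ ^ 2 = ∑' i, ‖a i‖ₑ ^ 2 := by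
  by_cases h0 : ∃ i, a i ≠ 0
  · obtain ⟨i, hi⟩ := h0
    have hz : ∀ j, j ≠ i → a j = 0 := fun j hj => by
      by_contra hne
      exact hj (h j i hne hi)
    have hs := hasSum_single i hz
    refine ⟨hs.summable.hasSum, ?_⟩
    rw [hs.tsum_eq, tsum_eq_single i fun j hj => by simp [hz j hj]]
  · push Not at h0
    have : a = 0 := funext h0
    subst this
    exact ⟨by simp only [Pi.zero_apply, tsum_zero]; exact hasSum_zero, by simp⟩

section Circle

lemma measurePreserving_coe_sub (x : ℝ) :
    MeasurePreserving (fun y : ℝ => ((x - y : ℝ) : UnitAddCircle))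
      (volume.restrict (Ioc (-(1 / 2) : ℝ) (1 / 2))) volume := by
  have h1 := UnitAddCircle.measurePreserving_mk (-(1 / 2))
  norm_num at h1
  exact ((volume : Measure UnitAddCircle).measurePreserving_sub_left (x : UnitAddCircle)).comp h1

lemma lintegral_Icc_coe_le (f : UnitAddCircle → ℝ≥0∞) :
    ∫⁻ y in Icc (-5 : ℝ) 6, f y ≤ 12 * ∫⁻ z, f z := by
  -- Twelve unit intervals rather than eleven: they are open on the left, so (-6, -5] is needed for
  -- the endpoint -5.
  have hsub : Icc (-5 : ℝ) 6 ⊆ ⋃ i : Fin 12, Ioc ((i : ℝ) - 6) ((i : ℝ) - 6 + 1) := by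
    intro y hy
    have h1 : 0 < ⌈y + 6⌉₊ := Nat.ceil_pos.2 (by linarith [hy.1])
    have h2 : ⌈y + 6⌉₊ ≤ 12 := Nat.ceil_le.2 (by push_cast; linarith [hy.2])
    refine mem_iUnion.2 ⟨⟨⌈y + 6⌉₊ - 1, by lia⟩, ?_⟩
    have h3 := Nat.le_ceil (y + 6)
    have h4 := Nat.ceil_lt_add_one (show 0 ≤ y + 6 by linarith [hy.1])
    have h5 : ((⌈y + 6⌉₊ - 1 : ℕ) : ℝ) = ⌈y + 6⌉₊ - 1 := by
      rw [Nat.cast_sub h1]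
      simp
    simp only [h5]
    constructor <;> linarith
  calc _ ≤ ∫⁻ y in ⋃ i : Fin 12, Ioc ((i : ℝ) - 6) ((i : ℝ) - 6 + 1), f y :=
        lintegral_mono_set hsub
    _ ≤ ∑' i : Fin 12, ∫⁻ y in Ioc ((i : ℝ) - 6) ((i : ℝ) - 6 + 1), f y := lintegral_iUnion_le _ _
    _ = _ := by
        simp_rw [UnitAddCircle.lintegral_preimage]
        simp

variable {ψ c b : ℝ → ℝ} {N M r : ℕ} {S δ : ℝ}

lemma eLpNorm_two_eq {X : Type*} [MeasurableSpace X] {μ : Measure X} (f : X → ℂ) :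
    eLpNorm f 2 μ = (∫⁻ x, ‖f x‖ₑ ^ 2 ∂μ) ^ (1 / 2 : ℝ) := by
  rw [eLpNorm_eq_lintegral_rpow_enorm_toReal (by norm_num) (by norm_num)]
  simp

lemma memLp_coe (f : L2T) :
    MemLp (fun y : ℝ => f (y : UnitAddCircle)) 2 (volume.restrict (Icc (-5 : ℝ) 6)) := by
  refine ⟨((Lp.stronglyMeasurable f).comp_measurable
    AddCircle.measurable_mk').aestronglyMeasurable, ?_⟩
  have h1 := Lp.eLpNorm_lt_top f
  rw [eLpNorm_two_eq] at h1 ⊢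
  rw [ENNReal.rpow_lt_top_iff_of_pos (by norm_num)] at h1 ⊢
  exact (lintegral_Icc_coe_le fun z => ‖f z‖ₑ ^ 2).trans_lt (ENNReal.mul_lt_top (by simp) h1)

lemma measurable_tileOp (hψ : Continuous ψ) (hc : Measurable c) (hb : Measurable b) (P : Tile)
    (f : L2T) : Measurable (tileOp ψ c b P f) := by
  refine Measurable.indicator ?_ (measurableSet_tileE hc hb P)
  simp only [intervalIntegral.integral_of_le (show (-(1 / 2) : ℝ) ≤ 1 / 2 by norm_num)]
  refine (StronglyMeasurable.integral_prod_right ?_).measurable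
  refine Measurable.stronglyMeasurable ?_
  have hb1 : Measurable fun z : ℝ × ℝ => b z.1 := hb.comp measurable_fst
  have hc1 : Measurable fun z : ℝ × ℝ => c z.1 := hc.comp measurable_fst
  refine Measurable.mul (Measurable.mul ?_ ?_) ?_
  · refine Complex.measurable_exp.comp (Measurable.const_mul (Complex.measurable_ofReal.comp ?_) _)
    simp only [Line.eval]
    fun_prop
  · refine Complex.measurable_ofReal.comp ?_
    unfold psiScale
    fun_prop
  · exact (Lp.stronglyMeasurable f).measurable.comp (AddCircle.measurable_mk'.comp (by fun_prop))

lemma integrable_tileOp (hψ : Continuous ψ) (hS : ∀ y, |ψ y| ≤ S) (P : Tile) (f : L2T) (x : ℝ) :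
    Integrable (fun y : ℝ => Complex.exp (Complex.I *
      (((Line.eval ⟨c x, b x⟩ x) * y - b x * y ^ 2 : ℝ) : ℂ)) * ((psiScale ψ P.k y : ℝ) : ℂ) *
        f ((x - y : ℝ) : UnitAddCircle)) (volume.restrict (Ioc (-(1 / 2) : ℝ) (1 / 2))) := by
  have hf : Integrable (fun y : ℝ => f ((x - y : ℝ) : UnitAddCircle))
      (volume.restrict (Ioc (-(1 / 2) : ℝ) (1 / 2))) :=
    (measurePreserving_coe_sub x).integrable_comp_of_integrable
      ((Lp.memLp f).integrable (by norm_num))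
  refine hf.bdd_mul (c := 2 ^ P.k * S) ?_ (Filter.Eventually.of_forall fun y => ?_)
  · refine Continuous.aestronglyMeasurable ?_
    unfold psiScale
    fun_prop
  · rw [norm_mul, mul_comm Complex.I, Complex.norm_exp_ofReal_mul_I, one_mul, Complex.norm_real,
      psiScale, Real.norm_eq_abs, abs_mul, abs_of_pos (by positivity)]
    gcongr
    exact hS _

/-- The representative of f + g is the sum only almost everywhere, but for each fixed x the map y ↦
x - y pulls null sets back to null sets, so additivity holds at every x. -/
lemma tileOp_add (hψ : Continuous ψ) (hS : ∀ y, |ψ y| ≤ S) (P : Tile) (f g : L2T) (x : ℝ) :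
    tileOp ψ c b P (f + g : L2T) x = tileOp ψ c b P f x + tileOp ψ c b P g x := by
  unfold tileOp
  by_cases hx : x ∈ tileE c b P
  · simp only [indicator_of_mem hx]
    simp only [intervalIntegral.integral_of_le (show (-(1 / 2) : ℝ) ≤ 1 / 2 by norm_num)]
    rw [← integral_add (integrable_tileOp hψ hS P f x) (integrable_tileOp hψ hS P g x)]
    refine integral_congr_ae ?_
    filter_upwards [(measurePreserving_coe_sub x).quasiMeasurePreserving.ae (Lp.coeFn_add f g)]
      with y hy
    rw [hy, Pi.add_apply, mul_add]
  · simp [hx]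

lemma tileOp_smul (P : Tile) (a : ℂ) (f : L2T) (x : ℝ) :
    tileOp ψ c b P (a • f : L2T) x = a * tileOp ψ c b P f x := by
  unfold tileOp
  by_cases hx : x ∈ tileE c b P
  · simp only [indicator_of_mem hx]
    simp only [intervalIntegral.integral_of_le (show (-(1 / 2) : ℝ) ≤ 1 / 2 by norm_num)]
    rw [← integral_const_mul]
    refine integral_congr_ae ?_
    filter_upwards [(measurePreserving_coe_sub x).quasiMeasurePreserving.ae (Lp.coeFn_smul a f)]
      with y hy
    rw [hy, Pi.smul_apply, smul_eq_mul]
    ring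
  · simp [hx]

/-- The pointwise sum `∑_{P ∈ 𝒬} T_P f(x)`. -/
noncomputable def familySum (ψ c b : ℝ → ℝ) (𝒬 : Set Tile) (f : UnitAddCircle → ℂ) (x : ℝ) : ℂ :=
  ∑' P : 𝒬, tileOp ψ c b P f x

variable {𝒬 : Set Tile}

/-- At most one term is nonzero at each x, so the series converges everywhere and squaring commutes
with summation. -/
lemma hasSum_tileOp (h𝒬 : ∀ P ∈ 𝒬, ∀ Q ∈ 𝒬, P ≠ Q → ¬ P.Le Q) (f : UnitAddCircle → ℂ) (x : ℝ) :
    HasSum (fun P : 𝒬 => tileOp ψ c b P f x) (familySum ψ c b 𝒬 f x) ∧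
      ‖familySum ψ c b 𝒬 f x‖ₑ ^ 2 = ∑' P : 𝒬, ‖tileOp ψ c b P f x‖ₑ ^ 2 := by
  refine hasSum_and_enorm_tsum_sq fun P Q hP hQ => ?_
  by_contra hne
  exact Set.disjoint_left.1 (disjoint_tileE h𝒬 P.2 Q.2 fun h => hne (Subtype.ext h))
    (mem_of_indicator_ne_zero hP) (mem_of_indicator_ne_zero hQ)

lemma measurable_familySum (hψ : Continuous ψ) (hc : Measurable c) (hb : Measurable b) (f : L2T) :
    Measurable (familySum ψ c b 𝒬 f) :=
  Measurable.tsum fun P : 𝒬 => measurable_tileOp hψ hc hb P f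

lemma lintegral_tileOp_sq_le (hsupp : ∀ y, 5 ≤ |y| → ψ y = 0) (hsupp4 : ∀ y, |y| ≤ 4 → ψ y = 0)
    (hc : Measurable c) (hb : Measurable b) (P : Tile) (f : UnitAddCircle → ℂ) :
    ∫⁻ x, ‖tileOp ψ c b P f x‖ₑ ^ 2 ≤ ∫⁻ x in tileE c b P,
      ‖∫ y in Icc (-5 : ℝ) 6, kernel ψ c b (fun _ => P.k) x y * f y‖ₑ ^ 2 := by
  rcases le_or_gt P.k 3 with hk | hk
  · simp [tileOp_eq_zero_of_k_le hsupp4 hk]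
  · rw [← lintegral_indicator (measurableSet_tileE hc hb P)]
    refine lintegral_mono fun x => ?_
    by_cases hx : x ∈ tileE c b P
    · simp [hx, tileOp_eq_integral_kernel hsupp hk f hx]
    · simp [hx, tileOp]

/-- The squared norm is a sum of nonnegative integrals over the tiles, hence the supremum over
finite subfamilies, for which the bound is uniform. -/
lemma lintegral_familySum_sq_le (hψ : ContDiff ℝ 1 ψ) (hS : ∀ y, |ψ y| ≤ S)
    (hS' : ∀ y, |deriv ψ y| ≤ S) (hsupp : ∀ y, 5 ≤ |y| → ψ y = 0)
    (hsupp4 : ∀ y, |y| ≤ 4 → ψ y = 0) (hc : Measurable c)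
    (hb : Measurable b) (hM : 1 ≤ M) (hδ : 0 < δ) (hδ1 : δ ≤ 1)
    (hsp : 𝒬 ⊆ sparseTiles M r) (h𝒬 : ∀ P ∈ 𝒬, ∀ Q ∈ 𝒬, P ≠ Q → ¬ P.Le Q)
    (hm : ∀ P ∈ 𝒬, mass (sparseTiles M r) N c b P ≤ δ) (f : L2T) :
    ∫⁻ x, ‖familySum ψ c b 𝒬 f x‖ₑ ^ 2
      ≤ ENNReal.ofReal (86400 * S ^ 2 * ((1 + 84 * 2 ^ M * 2 ^ (N + 2)) *
          δ ^ (1 / (4 * (N + 2)) : ℝ))) * (12 * ∫⁻ z, ‖f z‖ₑ ^ 2) := by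
  rw [lintegral_congr fun x => (hasSum_tileOp h𝒬 f x).2, lintegral_tsum fun P => ((measurable_tileOp hψ.continuous hc hb _ f).enorm.pow_const
    2).aemeasurable, ENNReal.tsum_eq_iSup_sum]
  refine iSup_le fun s => ?_
  have hmem : ∀ P ∈ s.map (Function.Embedding.subtype (· ∈ 𝒬)), P ∈ 𝒬 := fun P hP => by
    obtain ⟨Q, _, rfl⟩ := Finset.mem_map.1 hP
    exact Q.2
  calc ∑ P ∈ s, ∫⁻ x, ‖tileOp ψ c b P f x‖ₑ ^ 2
      = ∑ P ∈ s.map (Function.Embedding.subtype (· ∈ 𝒬)), ∫⁻ x, ‖tileOp ψ c b P f x‖ₑ ^ 2 := by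
        rw [Finset.sum_map]
        rfl
    _ ≤ _ := Finset.sum_le_sum fun P _ => lintegral_tileOp_sq_le hsupp hsupp4 hc hb P f
    _ ≤ _ := sum_lintegral_tileE_le (r := r) hψ hS hS' hsupp hc hb hM hδ hδ1 _
        (fun P hP => hsp (hmem P hP))
        (fun P hP Q hQ => h𝒬 P (hmem P hP) Q (hmem Q hQ)) (fun P hP => hm P (hmem P hP)) (memLp_coe f)
    _ ≤ _ := by
        gcongr
        exact lintegral_Icc_coe_le fun z => ‖f z‖ₑ ^ 2

/-- A function on `[0, 1)`, carried over to the circle. -/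
noncomputable def toCircle (u : ℝ → ℂ) (z : UnitAddCircle) : ℂ :=
  u (AddCircle.measurableEquivIco 1 0 z : ℝ)

lemma toCircle_coe (u : ℝ → ℂ) {x : ℝ} (hx : x ∈ Ico (0 : ℝ) 1) :
    toCircle u (x : UnitAddCircle) = u x := by
  have hx' : x ∈ Ico (0 : ℝ) (0 + 1) := by simpa using hx
  have : ((AddCircle.measurableEquivIco 1 0 (x : UnitAddCircle) : Ico (0 : ℝ) (0 + 1)) : ℝ) = x :=
    congrArg Subtype.val (AddCircle.equivIco_coe_eq hx')
  rw [toCircle, this]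

lemma measurable_toCircle {u : ℝ → ℂ} (hu : Measurable u) : Measurable (toCircle u) :=
  hu.comp (measurable_subtype_coe.comp (AddCircle.measurableEquivIco 1 0).measurable)

lemma lintegral_toCircle_le (u : ℝ → ℂ) : ∫⁻ z, ‖toCircle u z‖ₑ ^ 2 ≤ ∫⁻ x, ‖u x‖ₑ ^ 2 := by
  rw [← UnitAddCircle.lintegral_preimage 0, zero_add, setLIntegral_congr Ico_ae_eq_Ioc.symm,
    setLIntegral_congr_fun (g := fun x => ‖u x‖ₑ ^ 2) measurableSet_Ico
      fun x hx => by simp only [toCircle_coe u hx]]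
  exact setLIntegral_le_lintegral _ _

lemma ae_restrict_Ico_coe {p : UnitAddCircle → Prop} (h : ∀ᵐ z, p z) :
    ∀ᵐ x : ℝ ∂(volume.restrict (Ico (0 : ℝ) 1)), p x := by
  rw [Measure.restrict_congr_set Ico_ae_eq_Ioc]
  have := UnitAddCircle.measurePreserving_mk 0
  rw [zero_add] at this
  exact this.quasiMeasurePreserving.ae h

/-- The operator `∑_{P ∈ 𝒬} T_P` on `L²(𝕋)`. -/
lemma exists_isFamilyOp (hψ : Continuous ψ) (hS : ∀ y, |ψ y| ≤ S) (hc : Measurable c)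
    (hb : Measurable b) (h𝒬 : ∀ P ∈ 𝒬, ∀ Q ∈ 𝒬, P ≠ Q → ¬ P.Le Q) {A : ℝ} (hA : 0 ≤ A)
    (hbound : ∀ f : L2T, ∫⁻ x, ‖familySum ψ c b 𝒬 f x‖ₑ ^ 2
      ≤ ENNReal.ofReal (A ^ 2) * ∫⁻ z, ‖f z‖ₑ ^ 2) :
    ∃ T : L2T →L[ℂ] L2T, IsFamilyOp ψ c b 𝒬 T ∧ ‖T‖ ≤ A := by
  set V : L2T → UnitAddCircle → ℂ := fun f => toCircle (familySum ψ c b 𝒬 f) with hV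
  have hle : ∀ f : L2T, eLpNorm (V f) 2 volume ≤ ENNReal.ofReal A * eLpNorm f 2 volume := by
    intro f
    rw [eLpNorm_two_eq, eLpNorm_two_eq]
    calc (∫⁻ z, ‖V f z‖ₑ ^ 2) ^ (1 / 2 : ℝ)
        ≤ (ENNReal.ofReal (A ^ 2) * ∫⁻ z, ‖f z‖ₑ ^ 2) ^ (1 / 2 : ℝ) := by
          gcongr
          exact (lintegral_toCircle_le _).trans (hbound f)
      _ = _ := by
          rw [ENNReal.mul_rpow_of_nonneg _ _ (by norm_num),
            ENNReal.ofReal_rpow_of_nonneg (by positivity) (by norm_num), ← Real.sqrt_eq_rpow,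
            Real.sqrt_sq hA]
  have hmem : ∀ f : L2T, MemLp (V f) 2 volume := fun f =>
    ⟨(measurable_toCircle (measurable_familySum hψ hc hb f)).aestronglyMeasurable,
      (hle f).trans_lt (ENNReal.mul_lt_top (by simp) (Lp.eLpNorm_lt_top f))⟩
  have hadd : ∀ f g : L2T, V (f + g) = V f + V g := fun f g => funext fun z => by
    simp only [hV, toCircle, Pi.add_apply]
    refine HasSum.unique ?_ ((hasSum_tileOp h𝒬 f _).1.add (hasSum_tileOp h𝒬 g _).1)
    simp_rw [← tileOp_add hψ hS]
    exact (hasSum_tileOp h𝒬 _ _).1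
  have hsmul : ∀ (a : ℂ) (f : L2T), V (a • f) = a • V f := fun a f => funext fun z => by
    simp only [hV, toCircle, Pi.smul_apply, smul_eq_mul]
    refine HasSum.unique ?_ ((hasSum_tileOp h𝒬 f _).1.mul_left a)
    simp_rw [← tileOp_smul]
    exact (hasSum_tileOp h𝒬 _ _).1
  let T₀ : L2T →ₗ[ℂ] L2T :=
    { toFun := fun f => (hmem f).toLp (V f)
      map_add' := fun f g => by
        rw [← MemLp.toLp_add]
        exact MemLp.toLp_congr _ _ (by rw [hadd])
      map_smul' := fun a f => by
        rw [RingHom.id_apply, ← MemLp.toLp_const_smul]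
        exact MemLp.toLp_congr _ _ (by rw [hsmul]) }
  have hT₀ : ∀ f, ‖T₀ f‖ ≤ A * ‖f‖ := fun f => by
    have h1 : ‖T₀ f‖ = (eLpNorm (V f) 2 volume).toReal := Lp.norm_toLp _ (hmem f)
    rw [h1, Lp.norm_def, ← ENNReal.toReal_ofReal hA, ← ENNReal.toReal_mul]
    exact ENNReal.toReal_mono (ENNReal.mul_ne_top (by simp) (Lp.eLpNorm_ne_top f)) (hle f)
  refine ⟨T₀.mkContinuous A hT₀, fun f => ?_, LinearMap.mkContinuous_norm_le _ hA _⟩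
  have hT : (T₀.mkContinuous A hT₀ f : UnitAddCircle → ℂ) =ᵐ[volume] V f := MemLp.coeFn_toLp (hmem f)
  filter_upwards [ae_restrict_Ico_coe hT, ae_restrict_mem measurableSet_Ico] with x hx hx01
  simp only [hx, hV, toCircle_coe _ hx01]
  exact (hasSum_tileOp h𝒬 f x).1

end Circle

end QuadCarleson

/-! ### Choice of the constants. -/

theorem proposition1 (N : ℕ) :
    ∃ η : ℝ, 0 < η ∧ η < 1 / 2 ∧
      ∀ ψ : ℝ → ℝ, ContDiff ℝ (⊤ : ℕ∞) ψ → (∀ y, ψ (-y) = -ψ y) →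
        tsupport ψ ⊆ {y | 4 < |y| ∧ |y| < 5} →
      ∀ M : ℕ, 1 ≤ M →
      ∃ C : ℝ, 0 < C ∧
        ∀ c b : ℝ → ℝ, Measurable c → Measurable b →
        ∀ (r : ℕ) (δ : ℝ), 0 < δ →
        ∀ 𝒬 : Set Tile, 𝒬 ⊆ sparseTiles M r →
          (∀ P ∈ 𝒬, ∀ Q ∈ 𝒬, P ≠ Q → ¬ P.Le Q) →
          (∀ P ∈ 𝒬, mass (sparseTiles M r) N c b P ≤ δ) →
          ∃ S : L2T →L[ℂ] L2T, IsFamilyOp ψ c b 𝒬 S ∧ ‖S‖ ≤ C * δ ^ η := by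
  have hN : (0 : ℝ) ≤ N := N.cast_nonneg
  -- Half the exponent 1/(4(N + 2)) obtained for the squared norm.
  refine ⟨1 / (8 * (N + 2)), by positivity, ?_, ?_⟩
  · rw [div_lt_div_iff₀ (by positivity) (by norm_num)]
    linarith
  intro ψ hψ _ hψsupp M hM
  have hψ1 : ContDiff ℝ 1 ψ := hψ.of_le (by exact_mod_cast le_top)
  have hzero : ∀ y, ¬ (4 < |y| ∧ |y| < 5) → ψ y = 0 := fun y hy =>
    image_eq_zero_of_notMem_tsupport fun h => hy (hψsupp h)
  have hcs : HasCompactSupport ψ := by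
    refine (isCompact_closedBall (0 : ℝ) 5).of_isClosed_subset (isClosed_tsupport ψ) fun y hy => ?_
    rw [mem_closedBall_zero_iff, Real.norm_eq_abs]
    exact (hψsupp hy).2.le
  obtain ⟨S₁, hS₁⟩ := hcs.exists_bound_of_continuous hψ1.continuous
  obtain ⟨S₂, hS₂⟩ := hcs.deriv.exists_bound_of_continuous (hψ1.continuous_deriv (by norm_num))
  set S := max S₁ S₂
  have hS : ∀ y, |ψ y| ≤ S := fun y => (hS₁ y).trans (le_max_left _ _)
  have hS' : ∀ y, |deriv ψ y| ≤ S := fun y => (hS₂ y).trans (le_max_right _ _)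
  set B : ℝ := 12 * (86400 * S ^ 2 * (1 + 84 * 2 ^ M * 2 ^ (N + 2))) with hB
  have hB0 : 0 ≤ B := by positivity
  -- The added 1 keeps C positive when `B` vanishes.
  refine ⟨√B + 1, by positivity, fun c b hc hb r δ hδ 𝒬 hsp h𝒬 hm => ?_⟩
  -- Masses never exceed 1, so δ may be lowered to 1, as the choice K ≥ 1 requires.
  set δ' := min δ 1
  have hδ' : 0 < δ' := lt_min hδ one_pos
  have hm' : ∀ P ∈ 𝒬, mass (sparseTiles M r) N c b P ≤ δ' := fun P hP =>
    le_min (hm P hP) (mass_le_one P)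
  have hpow : 0 ≤ δ' ^ (1 / (8 * (N + 2)) : ℝ) := Real.rpow_nonneg hδ'.le _
  obtain ⟨T, hT, hTn⟩ := exists_isFamilyOp (A := √B * δ' ^ (1 / (8 * (N + 2)) : ℝ))
    hψ1.continuous hS hc hb h𝒬 (by positivity) fun f => by
      refine (lintegral_familySum_sq_le hψ1 hS hS' (fun y hy => hzero y fun h => by linarith [h.2])
        (fun y hy => hzero y fun h => by linarith [h.1]) hc hb hM hδ' (min_le_right _ _) hsp h𝒬 hm'
        f).trans_eq ?_
      rw [← mul_assoc, ← ENNReal.ofReal_ofNat 12, ← ENNReal.ofReal_mul (by positivity)]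
      congr 2
      have h1 : (δ' ^ (1 / (8 * (N + 2)) : ℝ)) ^ 2 = δ' ^ (1 / (4 * (N + 2)) : ℝ) := by
        rw [← Real.rpow_natCast, ← Real.rpow_mul hδ'.le]
        congr 1
        push_cast
        field_simp
        norm_num
      rw [mul_pow, h1, Real.sq_sqrt hB0, hB]
      ring
  refine ⟨T, hT, hTn.trans ?_⟩
  gcongr
  · linarith
  · exact min_le_left _ _
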